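/- Let $\mathbb{T}^d=\mathbb{R}^d/\mathbb{Z}^d$ and $T>0$, and write $L^pL^q$ for $L^p([0,T];L^q(\mathbb{T}^d))$; here $L^\infty L^\infty$ is $L^\infty([0,T]\times\mathbb{T}^d)$, the dual of $L^1L^1$. Let $u\in L^1([0,T];L^1(\mathbb{T}^d;\mathbb{R}^d))$ with $\nabla\cdot u=0$ in the sense of distributions, and let $f_0\in L^\infty(\mathbb{T}^d)$. For $\nu\ge 0$, a weak solution of $\partial_t g+\nabla\cdot(ug)-\nu\Delta g=0$ along $u$ with initial data $g_0\in L^1(\mathbb{T}^d)$ is a function $g\in L^1L^1$ with $ug\in L^1L^1$ such that $$\int_{\mathbb{T}^d\times[0,T]} g\left(\partial_t\phi+u\cdot\nabla\phi+\nu\Delta\phi\right)dx\,dt=-\int_{\mathbb{T}^d}g_0\,\phi(\cdot,0)\,dx\qquad\text{for all }\phi\in C_c^\infty(\mathbb{T}^d\times[0,T)).$$ For $\nu=0$ this is the transport equation. A weak solution $g$ of the transport equation with initial data $g_0$ is renormalised if, for every bounded continuous $\beta:\mathbb{R}\to\mathbb{R}$, $\beta(g)$ is a weak solution of the transport equation along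 $u$ with initial data $\beta(g_0)$. Suppose that the transport equation along $u$ with initial data $f_0$ has a weak solution $f\in L^\infty L^\infty$, that $f$ is the only weak solution in the class $L^\infty L^\infty$ (up to equality almost everywhere), and that $f$ is renormalised. For each $\nu>0$ let $f^\nu$ be any weak solution of $\partial_t f^\nu+\nabla\cdot(uf^\nu)-\nu\Delta f^\nu=0$ along $u$ with initial data $f_0$. Suppose that $f^\nu$ (has a representative that) is a weak-$*$ continuous map $[0,T]\to L^\infty(\mathbb{T}^d)$ and satisfies $$\|f^\nu(\cdot,t)\|_{L^p(\mathbb{T}^d)}\le\|f_0\|_{L^p(\mathbb{T}^d)}\qquad\text{for all }t\in[0,T]\text{ and all }p\in[1,\infty].$$ Then, as $\nu\to0$, $f^\nu\to f$ weak-$*$ in $L^\infty L^\infty$ and, for each $p\in[1,\infty)$, strongly in $L^pL^p$. If additionally $f\in C^0([0,T];L^1(\mathbb{T}^d))$, then for each $p\in[1,\infty)$ also $f^\nu\to f$ strongly in $L^\infty L^p$ as $\nu\to0$. -/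

import Mathlib

open MeasureTheory Filter Topology Set
open scoped ENNReal BoundedContinuousFunction

namespace VanishingViscosity

noncomputable section

/-- The flat torus `ℝ^d / ℤ^d`; its `volume` is Lebesgue measure of total mass one. -/
abbrev Torus (d : ℕ) : Type := UnitAddTorus (Fin d)

/-- Lebesgue measure on the time interval `[0,T]`. -/
abbrev timeMeasure (T : ℝ) : Measure ℝ := volume.restrict (Icc 0 T)

/-- Lebesgue measure on `[0,T] × 𝕋^d`. Space-time points are written `(t, x)`. -/
abbrev spaceTime (d : ℕ) (T : ℝ) : Measure (ℝ × Torus d) :=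
  (timeMeasure T).prod (volume : Measure (Torus d))

/-- The norm of `L^p([0,T]; L^q(𝕋^d; E))`. -/
def mixedNorm {d : ℕ} {E : Type*} [NormedAddCommGroup E] (T : ℝ) (p q : ℝ≥0∞)
    (f : ℝ → Torus d → E) : ℝ≥0∞ :=
  eLpNorm (fun t => eLpNorm (f t) q volume) p (timeMeasure T)

/-- `f ∈ L^p([0,T]; L^q(𝕋^d; E))`, for functions on space-time. For `p = q = ∞` this is
`L^∞([0,T] × 𝕋^d)`, the dual of `L^1([0,T]; L^1(𝕋^d))`. -/
def MemMixed {d : ℕ} {E : Type*} [NormedAddCommGroup E] (T : ℝ) (p q : ℝ≥0∞)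
    (f : ℝ → Torus d → E) : Prop :=
  AEStronglyMeasurable (fun z : ℝ × Torus d => f z.1 z.2) (spaceTime d T) ∧
    mixedNorm T p q f < ∞

/-- The `i`-th partial derivative of a function on the torus. -/
def partialDeriv {d : ℕ} (i : Fin d) (φ : Torus d → ℝ) (x : Torus d) : ℝ :=
  deriv (fun s : ℝ => φ (x + Pi.single i (s : UnitAddCircle))) 0

/-- The spatial gradient. -/
def grad {d : ℕ} (φ : Torus d → ℝ) (x : Torus d) : EuclideanSpace ℝ (Fin d) :=
  WithLp.toLp 2 (fun i => partialDeriv i φ x)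

/-- The spatial Laplacian. -/
def laplacian {d : ℕ} (φ : Torus d → ℝ) (x : Torus d) : ℝ :=
  ∑ i, partialDeriv i (partialDeriv i φ) x

/-- The time derivative. -/
def timeDeriv {d : ℕ} (φ : ℝ → Torus d → ℝ) (t : ℝ) (x : Torus d) : ℝ :=
  deriv (fun s => φ s x) t

/-- Smoothness on `ℝ × 𝕋^d`: the periodic lift to `ℝ × ℝ^d` is `C^∞`. -/
def IsSmooth {d : ℕ} (φ : ℝ → Torus d → ℝ) : Prop :=
  ContDiff ℝ ((⊤ : ℕ∞) : WithTop ℕ∞) (fun z : ℝ × (Fin d → ℝ) => φ z.1 (fun i => (z.2 i : UnitAddCircle)))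

/-- Test functions in `C_c^∞(𝕋^d × [0,T))`: restrictions to `t ≥ 0` of smooth functions that
vanish from some time before `T` on. They need not vanish at `t = 0`. -/
def IsTestHalfOpen {d : ℕ} (T : ℝ) (φ : ℝ → Torus d → ℝ) : Prop :=
  IsSmooth φ ∧ ∃ b < T, ∀ t, b ≤ t → ∀ x, φ t x = 0

/-- Test functions in `C_c^∞(𝕋^d × (0,T))`. -/
def IsTestOpen {d : ℕ} (T : ℝ) (φ : ℝ → Torus d → ℝ) : Prop :=
  IsSmooth φ ∧ ∃ a b, 0 < a ∧ b < T ∧ ∀ t, t ∉ Icc a b → ∀ x, φ t x = 0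

/-- `∇ · u = 0` in the sense of distributions on `𝕋^d × (0,T)`. -/
def IsDivFree {d : ℕ} (T : ℝ) (u : ℝ → Torus d → EuclideanSpace ℝ (Fin d)) : Prop :=
  ∀ φ : ℝ → Torus d → ℝ, IsTestOpen T φ →
    ∫ z, inner ℝ (u z.1 z.2) (grad (φ z.1) z.2) ∂(spaceTime d T) = 0

/-- `f` is a weak solution of `∂f/∂t + ∇·(u f) = 0` with initial data `f₀`. -/
structure IsWeakSolTE {d : ℕ} (T : ℝ) (u : ℝ → Torus d → EuclideanSpace ℝ (Fin d))
    (f₀ : Torus d → ℝ) (f : ℝ → Torus d → ℝ) : Prop where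
  mem : MemMixed T 1 1 f
  mem_flux : MemMixed T 1 1 (fun t x => f t x • u t x)
  mem_init : MemLp f₀ 1 volume
  weak_eq : ∀ φ : ℝ → Torus d → ℝ, IsTestHalfOpen T φ →
    ∫ z, f z.1 z.2 * (timeDeriv φ z.1 z.2 + inner ℝ (u z.1 z.2) (grad (φ z.1) z.2))
        ∂(spaceTime d T)
      = - ∫ x, f₀ x * φ 0 x

/-- `f` is a weak solution of `∂f/∂t + ∇·(u f) - ν Δf = 0` with initial data `f₀`. -/
structure IsWeakSolADE {d : ℕ} (T ν : ℝ) (u : ℝ → Torus d → EuclideanSpace ℝ (Fin d))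
    (f₀ : Torus d → ℝ) (f : ℝ → Torus d → ℝ) : Prop where
  mem : MemMixed T 1 1 f
  mem_flux : MemMixed T 1 1 (fun t x => f t x • u t x)
  mem_init : MemLp f₀ 1 volume
  weak_eq : ∀ φ : ℝ → Torus d → ℝ, IsTestHalfOpen T φ →
    ∫ z, f z.1 z.2 * (timeDeriv φ z.1 z.2 + inner ℝ (u z.1 z.2) (grad (φ z.1) z.2)
        + ν * laplacian (φ z.1) z.2) ∂(spaceTime d T)
      = - ∫ x, f₀ x * φ 0 x

/-- Renormalised weak solutions of the transport equation. -/
def IsRenormalised {d : ℕ} (T : ℝ) (u : ℝ → Torus d → EuclideanSpace ℝ (Fin d))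
    (f₀ : Torus d → ℝ) (f : ℝ → Torus d → ℝ) : Prop :=
  IsWeakSolTE T u f₀ f ∧
    ∀ β : ℝ →ᵇ ℝ, IsWeakSolTE T u (fun x => β (f₀ x)) (fun t x => β (f t x))

/-- `f` is the unique weak solution of the transport equation in the class `L^∞ L^∞`. -/
def IsUniqueBoundedSolTE {d : ℕ} (T : ℝ) (u : ℝ → Torus d → EuclideanSpace ℝ (Fin d))
    (f₀ : Torus d → ℝ) (f : ℝ → Torus d → ℝ) : Prop :=
  MemMixed T ∞ ∞ f ∧ IsWeakSolTE T u f₀ f ∧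
    ∀ g : ℝ → Torus d → ℝ, MemMixed T ∞ ∞ g → IsWeakSolTE T u f₀ g →
      ∀ᵐ z ∂(spaceTime d T), g z.1 z.2 = f z.1 z.2

/-- The curves `t ↦ f(·,t)` and `t ↦ g(·,t)` agree, as function classes on `𝕋^d`, for
almost every `t ∈ [0,T]`. -/
def IsRepresentative {d : ℕ} (T : ℝ) (f g : ℝ → Torus d → ℝ) : Prop :=
  ∀ᵐ t ∂(timeMeasure T), f t =ᵐ[volume] g t

/-- `t ↦ g(·,t)` is a curve `[0,T] → L^∞(𝕋^d)` continuous for the weak-* topology. -/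
def WeakStarContinuous {d : ℕ} (T : ℝ) (g : ℝ → Torus d → ℝ) : Prop :=
  (∀ t ∈ Icc 0 T, MemLp (g t) ∞ volume) ∧
    ∀ h : Torus d → ℝ, MemLp h 1 volume →
      ContinuousOn (fun t => ∫ x, g t x * h x) (Icc 0 T)

/-- `‖g(·,t)‖_{L^p} ≤ ‖f₀‖_{L^p}` for all `t ∈ [0,T]` and all `p ∈ [1,∞]`. -/
def InitialLpInequality {d : ℕ} (T : ℝ) (f₀ : Torus d → ℝ) (g : ℝ → Torus d → ℝ) : Prop :=
  ∀ p : ℝ≥0∞, 1 ≤ p → ∀ t ∈ Icc 0 T, eLpNorm (g t) p volume ≤ eLpNorm f₀ p volume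

/-- `t ↦ g(·,t)` is a norm-continuous curve `[0,T] → L^1(𝕋^d)`. -/
def StrongL1Continuous {d : ℕ} (T : ℝ) (g : ℝ → Torus d → ℝ) : Prop :=
  (∀ t ∈ Icc 0 T, MemLp (g t) 1 volume) ∧
    ∀ s ∈ Icc 0 T,
      Tendsto (fun t => eLpNorm (fun x => g t x - g s x) 1 volume) (𝓝[Icc 0 T] s) (𝓝 0)

/-- `f ∈ C^0([0,T]; L^1(𝕋^d))`, as a function class on space-time. -/
def MemC0L1 {d : ℕ} (T : ℝ) (f : ℝ → Torus d → ℝ) : Prop :=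
  ∃ g, IsRepresentative T f g ∧ StrongL1Continuous T g

/-- `F ν → f` as `ν → 0⁺` in the weak-* topology of `L^∞ L^∞ = (L^1 L^1)^*`. -/
def TendstoWeakStar {d : ℕ} (T : ℝ) (F : ℝ → ℝ → Torus d → ℝ) (f : ℝ → Torus d → ℝ) : Prop :=
  (∀ ν > 0, MemMixed T ∞ ∞ (F ν)) ∧ MemMixed T ∞ ∞ f ∧
    ∀ g : ℝ → Torus d → ℝ, MemMixed T 1 1 g →
      Tendsto (fun ν => ∫ z, F ν z.1 z.2 * g z.1 z.2 ∂(spaceTime d T)) (𝓝[>] 0)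
        (𝓝 (∫ z, f z.1 z.2 * g z.1 z.2 ∂(spaceTime d T)))

/-- `F ν → f` as `ν → 0⁺` in the norm of `L^p L^q`. -/
def TendstoMixed {d : ℕ} (T : ℝ) (p q : ℝ≥0∞) (F : ℝ → ℝ → Torus d → ℝ)
    (f : ℝ → Torus d → ℝ) : Prop :=
  (∀ ν > 0, MemMixed T p q (F ν)) ∧ MemMixed T p q f ∧
    Tendsto (fun ν => mixedNorm T p q (fun t x => F ν t x - f t x)) (𝓝[>] 0) (𝓝 0)

end

end VanishingViscosity

open VanishingViscosity

namespace VanishingViscosity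

/-! Weak-* convergence is compactness plus uniqueness. The `L^p` inequality with `p = ∞` bounds the
viscous solutions uniformly, so they converge weakly-* along every ultrafilter finer than `𝓝[>] 0`.
The equation is linear, and once the Laplacian is moved onto the test function the viscous term is
`O(ν)`. The limit is therefore a bounded solution of the transport equation, hence `f`
(`tendsto_weakStar_of_unique`).

Strong convergence comes from energy. Renormalisation with a truncated square shows that `∫ f(t)^2 =
∫ f₀^2` for almost every `t` (`IsRenormalised.ae_integral_sq`), while the viscous energy is at most
`∫ f₀^2`. Norms that do not exceed the norm of the weak limit force strong convergence in `L^2`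
(`tendsto_integral_sub_sq`), and the uniform bound carries this to every finite `p`.

For uniformity in time, the energy inequality on one slice gives `‖F(t) - f(t)‖² ≤ -2 ⟨F(t) - f(t),
f(t)⟩`. If `f` is continuous into `L^1`, its values form a compact set there, so finitely many
smooth `h` approximate all the `f(t)`. For fixed `h` the equation for the difference bounds `⟨F(t) -
f(t), h⟩` by a space-time quantity that is independent of `t` and tends to zero
(`ae_abs_integral_sub_mul_le`). -/

instance : IsProbabilityMeasure (volume : Measure UnitAddCircle) := ⟨UnitAddCircle.measure_univ⟩

/-! ### Smooth functions on `ℝ × 𝕋^d` -/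

/-- The covering map `ℝ × ℝ^d → ℝ × 𝕋^d`. -/
def cover (d : ℕ) (z : ℝ × (Fin d → ℝ)) : ℝ × Torus d :=
  (z.1, fun i => (z.2 i : UnitAddCircle))

/-- Smoothness is defined on the periodic lift; the quotient property lets continuity descend to the
torus, where compactness then gives bounds. -/
theorem isOpenQuotientMap_cover (d : ℕ) : IsOpenQuotientMap (cover d) := by
  have h : IsOpenQuotientMap (fun (y : Fin d → ℝ) (i : Fin d) => (y i : UnitAddCircle)) :=
    IsOpenQuotientMap.piMap fun _ => QuotientAddGroup.isOpenQuotientMap_mk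
  exact IsOpenQuotientMap.id.prodMap h

theorem IsSmooth.continuous {d : ℕ} {φ : ℝ → Torus d → ℝ} (hφ : IsSmooth φ) :
    Continuous (fun z : ℝ × Torus d => φ z.1 z.2) := by
  rw [(isOpenQuotientMap_cover d).isQuotientMap.continuous_iff]
  exact ContDiff.continuous hφ

theorem IsSmooth.continuous_slice {d : ℕ} {φ : ℝ → Torus d → ℝ} (hφ : IsSmooth φ) (t : ℝ) :
    Continuous (φ t) :=
  hφ.continuous.comp (by fun_prop : Continuous fun x : Torus d => (t, x))

theorem coe_update_line {d : ℕ} (y : Fin d → ℝ) (i : Fin d) (s : ℝ) :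
    ((fun j => (y j : UnitAddCircle)) + Pi.single i (s : UnitAddCircle) : Torus d) =
      fun j => ((y + s • Pi.single i (1 : ℝ) : Fin d → ℝ) j : UnitAddCircle) := by
  funext j
  by_cases h : j = i
  · subst h; simp
  · simp [h]

/-- On the lift this is the Fréchet derivative in a fixed direction, so smoothness is inherited and
the operation can be iterated. -/
theorem IsSmooth.partialDeriv {d : ℕ} {φ : ℝ → Torus d → ℝ} (hφ : IsSmooth φ) (i : Fin d) :
    IsSmooth (fun t => VanishingViscosity.partialDeriv i (φ t)) := by
  unfold IsSmooth at hφ ⊢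
  set Φ := fun z : ℝ × (Fin d → ℝ) => φ z.1 (fun i => (z.2 i : UnitAddCircle)) with hΦ
  have h : (fun z : ℝ × (Fin d → ℝ) => VanishingViscosity.partialDeriv i (φ z.1)
      (fun i => (z.2 i : UnitAddCircle))) = fun z => fderiv ℝ Φ z (0, Pi.single i 1) := by
    funext z
    have hd : DifferentiableAt ℝ Φ z := hφ.differentiable (by simp) z
    have := hd.hasFDerivAt.hasLineDerivAt (0, Pi.single i 1)
    rw [← this.lineDeriv]
    simp only [VanishingViscosity.partialDeriv, lineDeriv, coe_update_line]
    simp [hΦ]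
  rw [h]
  exact (hφ.fderiv_right (m := ((⊤ : ℕ∞) : WithTop ℕ∞)) (by simp)).clm_apply contDiff_const

theorem IsSmooth.timeDeriv {d : ℕ} {φ : ℝ → Torus d → ℝ} (hφ : IsSmooth φ) :
    IsSmooth (VanishingViscosity.timeDeriv φ) := by
  unfold IsSmooth at hφ ⊢
  set Φ := fun z : ℝ × (Fin d → ℝ) => φ z.1 (fun i => (z.2 i : UnitAddCircle)) with hΦ
  have h : (fun z : ℝ × (Fin d → ℝ) => VanishingViscosity.timeDeriv φ z.1
      (fun i => (z.2 i : UnitAddCircle))) = fun z => fderiv ℝ Φ z (1, 0) := by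
    funext z
    have hd : HasFDerivAt Φ (fderiv ℝ Φ z) (z.1, z.2) :=
      (hφ.differentiable (by simp) z).hasFDerivAt
    have h2 : HasDerivAt (fun s : ℝ => (s, z.2)) ((1 : ℝ), (0 : Fin d → ℝ)) z.1 :=
      (hasDerivAt_id z.1).prodMk (hasDerivAt_const z.1 z.2)
    exact (hd.comp_hasDerivAt z.1 h2).deriv
  rw [h]
  exact (hφ.fderiv_right (m := ((⊤ : ℕ∞) : WithTop ℕ∞)) (by simp)).clm_apply contDiff_const

theorem IsSmooth.laplacian {d : ℕ} {φ : ℝ → Torus d → ℝ} (hφ : IsSmooth φ) :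
    IsSmooth (fun t => VanishingViscosity.laplacian (φ t)) := by
  unfold IsSmooth
  simp only [VanishingViscosity.laplacian]
  exact ContDiff.sum fun i _ => (hφ.partialDeriv i).partialDeriv i

theorem IsSmooth.continuous_grad {d : ℕ} {φ : ℝ → Torus d → ℝ} (hφ : IsSmooth φ) :
    Continuous (fun z : ℝ × Torus d => grad (φ z.1) z.2) := by
  unfold grad
  exact (PiLp.continuous_toLp 2 _).comp
    (continuous_pi fun i => (hφ.partialDeriv i).continuous)

theorem exists_bound_of_continuous {d : ℕ} {E : Type*} [NormedAddCommGroup E] (T : ℝ)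
    {Φ : ℝ × Torus d → E} (hΦ : Continuous Φ) :
    ∃ B, 0 ≤ B ∧ ∀ᵐ z ∂(spaceTime d T), ‖Φ z‖ ≤ B := by
  obtain ⟨B, hB⟩ := ((isCompact_Icc (a := (0 : ℝ)) (b := T)).prod
    (isCompact_univ (X := Torus d))).exists_bound_of_continuousOn hΦ.continuousOn
  refine ⟨max B 0, le_max_right _ _, ?_⟩
  have h : ∀ᵐ t ∂(timeMeasure T), t ∈ Icc 0 T := ae_restrict_mem measurableSet_Icc
  have h' := Measure.quasiMeasurePreserving_fst (μ := timeMeasure T)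
    (ν := (volume : Measure (Torus d))) |>.ae h
  filter_upwards [h'] with z hz
  exact (hB z ⟨hz, trivial⟩).trans (le_max_left _ _)

/-! ### Separated test functions `η(t) h(x)` -/

theorem isSmooth_mul {d : ℕ} {η : ℝ → ℝ} (hη : ContDiff ℝ ((⊤ : ℕ∞) : WithTop ℕ∞) η)
    {h : Torus d → ℝ} (hh : IsSmooth fun _ : ℝ => h) : IsSmooth (fun t x => η t * h x) :=
  (hη.comp contDiff_fst).mul hh

theorem partialDeriv_const_mul {d : ℕ} (i : Fin d) (c : ℝ) (h : Torus d → ℝ) :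
    partialDeriv i (fun x => c * h x) = fun x => c * partialDeriv i h x := by
  funext x
  simp only [partialDeriv, deriv_const_mul_field]

theorem grad_const_mul {d : ℕ} (c : ℝ) (h : Torus d → ℝ) (x : Torus d) :
    grad (fun x => c * h x) x = c • grad h x := by
  simp only [grad, partialDeriv_const_mul]
  rfl

theorem laplacian_const_mul {d : ℕ} (c : ℝ) (h : Torus d → ℝ) (x : Torus d) :
    laplacian (fun x => c * h x) x = c * laplacian h x := by
  simp only [laplacian, partialDeriv_const_mul, Finset.mul_sum]

theorem timeDeriv_mul_const {d : ℕ} (η : ℝ → ℝ) (h : Torus d → ℝ) (t : ℝ) (x : Torus d) :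
    timeDeriv (fun t x => η t * h x) t x = deriv η t * h x := by
  simp only [timeDeriv, deriv_mul_const_field]

/-! ### Density of smooth functions in `L^1(𝕋^d)` -/

theorem isSmooth_re_mul_mFourier {d : ℕ} (c : ℂ) (n : Fin d → ℤ) :
    IsSmooth (fun (_ : ℝ) (x : Torus d) => (c * UnitAddTorus.mFourier n x).re) := by
  have h : ContDiff ℝ ((⊤ : ℕ∞) : WithTop ℕ∞) (fun z : ℝ × (Fin d → ℝ) =>
      c * UnitAddTorus.mFourier n (fun i => (z.2 i : UnitAddCircle))) := by
    simp only [UnitAddTorus.mFourier, ContinuousMap.coe_mk, fourier_coe_apply]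
    refine contDiff_const.mul (contDiff_prod fun i _ => ?_)
    have h1 : ContDiff ℝ ((⊤ : ℕ∞) : WithTop ℕ∞) (fun z : ℝ × (Fin d → ℝ) => ((z.2 i : ℝ) : ℂ)) :=
      Complex.ofRealCLM.contDiff.comp (by fun_prop)
    fun_prop
  exact Complex.reCLM.contDiff.comp h

theorem isSmooth_re_of_mem_span {d : ℕ} {g : C(UnitAddTorus (Fin d), ℂ)}
    (hg : g ∈ Submodule.span ℂ (range (UnitAddTorus.mFourier (d := Fin d)))) :
    IsSmooth (fun (_ : ℝ) (x : Torus d) => (g x).re) := by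
  obtain ⟨c, rfl⟩ := (Finsupp.mem_span_range_iff_exists_finsupp).1 hg
  have : (fun (_ : ℝ) (x : Torus d) =>
      (((c.sum fun i a => a • UnitAddTorus.mFourier i) : C(UnitAddTorus (Fin d), ℂ)) x).re) =
      fun _ x => ∑ i ∈ c.support, (c i * UnitAddTorus.mFourier i x).re := by
    funext _ x
    simp [Finsupp.sum, ContinuousMap.sum_apply]
  rw [this]
  exact ContDiff.sum fun i _ => isSmooth_re_mul_mFourier (c i) i

/-- Bounded continuous functions are dense in `L^1`, and trigonometric polynomials are uniformly
dense among continuous functions. The torus has mass one, so a uniform error is also an `L^1` error;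
the total is at most `ε / 2 + ε / 3`. -/
theorem exists_smooth_integral_abs_sub_lt {d : ℕ} {g : Torus d → ℝ} (hg : Integrable g volume)
    {ε : ℝ} (hε : 0 < ε) :
    ∃ h : Torus d → ℝ, IsSmooth (fun _ : ℝ => h) ∧ ∫ x, |g x - h x| < ε := by
  obtain ⟨k, hk, hki⟩ := hg.exists_boundedContinuous_integral_sub_le (half_pos hε)
  let K : C(UnitAddTorus (Fin d), ℂ) := ⟨fun x => (k x : ℂ), by fun_prop⟩
  have hK : K ∈ closure ((Submodule.span ℂ (range (UnitAddTorus.mFourier (d := Fin d))) :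
      Submodule ℂ C(UnitAddTorus (Fin d), ℂ)) : Set C(UnitAddTorus (Fin d), ℂ)) := by
    rw [← Submodule.topologicalClosure_coe, UnitAddTorus.span_mFourier_closure_eq_top]
    trivial
  obtain ⟨L, hL, hKL⟩ := Metric.mem_closure_iff.1 hK (ε / 3) (by positivity)
  have hsm := isSmooth_re_of_mem_span hL
  refine ⟨fun x => (L x).re, hsm, ?_⟩
  have hLi : Integrable (fun x : Torus d => (L x).re) volume :=
    (hsm.continuous_slice 0).integrable_of_hasCompactSupport (HasCompactSupport.of_compactSpace _)
  have hpt : ∀ x, |k x - (L x).re| ≤ ε / 3 := fun x => by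
    have h1 : ‖K x - L x‖ ≤ ε / 3 := by
      rw [← dist_eq_norm]
      exact (ContinuousMap.dist_apply_le_dist x).trans hKL.le
    have h2 := (Complex.abs_re_le_norm (K x - L x)).trans h1
    simpa [K] using h2
  calc ∫ x, |g x - (L x).re| ≤ ∫ x, (‖g x - k x‖ + ε / 3) := by
        refine integral_mono ((hg.sub hLi).abs) ((hg.sub hki).norm.add (integrable_const _))
          fun x => ?_
        have := abs_sub_le (g x) (k x) (L x).re
        rw [Real.norm_eq_abs]
        linarith [hpt x]
    _ = (∫ x, ‖g x - k x‖) + ε / 3 := by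
        have hi : Integrable (fun x => ‖g x - k x‖) volume := (hg.sub hki).norm
        rw [integral_add hi (integrable_const _)]
        simp
    _ < ε := by linarith

/-! ### Weak-* compactness of bounded families -/

section WeakStar

variable {α ι : Type*} [MeasurableSpace α] {μ : Measure α}

theorem abs_integral_mul_le {φ k : α → ℝ} {C : ℝ} (hφ : ∀ᵐ z ∂μ, |φ z| ≤ C)
    (hk : Integrable k μ) : |∫ z, φ z * k z ∂μ| ≤ C * ∫ z, |k z| ∂μ := by
  rw [← integral_const_mul, ← Real.norm_eq_abs]
  refine norm_integral_le_of_norm_le (hk.abs.const_mul C) ?_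
  filter_upwards [hφ] with z hz
  rw [norm_mul, Real.norm_eq_abs, Real.norm_eq_abs]
  exact mul_le_mul_of_nonneg_right hz (abs_nonneg _)

theorem Integrable.bdd_mul_ae {φ k : α → ℝ} {C : ℝ} (hk : Integrable k μ)
    (hφm : AEStronglyMeasurable φ μ) (hφ : ∀ᵐ z ∂μ, |φ z| ≤ C) :
    Integrable (fun z => φ z * k z) μ :=
  hk.bdd_mul hφm hφ

/-- For bounded families, convergence against `L^2` functions implies convergence against
`L^1` functions. -/
theorem tendsto_integral_mul_of_memLp_two [IsFiniteMeasure μ] {l : Filter ι} {φ : ι → α → ℝ}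
    {g : α → ℝ} {C : ℝ}
    (hφ : ∀ᶠ i in l, AEStronglyMeasurable (φ i) μ ∧ ∀ᵐ z ∂μ, |φ i z| ≤ C)
    (hgm : AEStronglyMeasurable g μ) (hg : ∀ᵐ z ∂μ, |g z| ≤ C)
    (h2 : ∀ h : α → ℝ, MemLp h 2 μ →
      Tendsto (fun i => ∫ z, φ i z * h z ∂μ) l (𝓝 (∫ z, g z * h z ∂μ)))
    {h : α → ℝ} (hh : Integrable h μ) :
    Tendsto (fun i => ∫ z, φ i z * h z ∂μ) l (𝓝 (∫ z, g z * h z ∂μ)) := by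
  rw [Metric.tendsto_nhds]
  intro ε hε
  -- Replacing `h` by a simple function costs `ε / 4` for `φ i` and again for `g`, leaving `ε / 4`
  -- for the convergence itself. The `+ 1` avoids division by zero.
  have hδ : 0 < ε / (4 * (|C| + 1)) := by positivity
  obtain ⟨s, hs, -⟩ := (memLp_one_iff_integrable.2 hh).exists_simpleFunc_eLpNorm_sub_lt
    (by simp) (ENNReal.ofReal_pos.2 hδ).ne'
  have hs2 : MemLp s 2 μ := s.memLp_of_isFiniteMeasure 2 μ
  have hsi : Integrable s μ := s.integrable_of_isFiniteMeasure
  have hsub : Integrable (fun z => h z - s z) μ := hh.sub hsi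
  have hsmall : |C| * ∫ z, |h z - s z| ∂μ ≤ ε / 4 := by
    have h1 : ∫ z, |h z - s z| ∂μ ≤ ε / (4 * (|C| + 1)) := by
      rw [eLpNorm_one_eq_lintegral_enorm] at hs
      have := integral_norm_eq_lintegral_enorm hsub.aestronglyMeasurable
      simp only [Real.norm_eq_abs] at this
      rw [this]
      exact ENNReal.toReal_le_of_le_ofReal hδ.le hs.le
    calc |C| * ∫ z, |h z - s z| ∂μ ≤ (|C| + 1) * (ε / (4 * (|C| + 1))) := by
          gcongr
          linarith
      _ = ε / 4 := by field_simp
  have key : ∀ ψ : α → ℝ, AEStronglyMeasurable ψ μ → (∀ᵐ z ∂μ, |ψ z| ≤ C) →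
      |(∫ z, ψ z * h z ∂μ) - ∫ z, ψ z * s z ∂μ| ≤ ε / 4 := fun ψ hm hb => by
    rw [← integral_sub (Integrable.bdd_mul_ae hh hm hb) (Integrable.bdd_mul_ae hsi hm hb)]
    simp only [← mul_sub]
    exact (abs_integral_mul_le (hb.mono fun z hz => hz.trans (le_abs_self C)) hsub).trans hsmall
  filter_upwards [hφ, (Metric.tendsto_nhds.1 (h2 s hs2)) (ε / 4) (by positivity)] with i hi hd
  have h3 := key (φ i) hi.1 hi.2
  have h4 := key g hgm hg
  rw [Real.dist_eq] at hd ⊢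
  rw [abs_le] at h3 h4
  rw [abs_lt] at hd ⊢
  constructor <;> linarith

/-- A family of functions bounded in `L^∞` of a finite measure converges weakly-* along every
ultrafilter. -/
theorem exists_weakStar_limit [IsFiniteMeasure μ] (U : Ultrafilter ι) {φ : ι → α → ℝ} {C : ℝ}
    (hφ : ∀ᶠ i in (U : Filter ι), AEStronglyMeasurable (φ i) μ ∧ ∀ᵐ z ∂μ, |φ i z| ≤ C) :
    ∃ g : α → ℝ, AEStronglyMeasurable g μ ∧ (∀ᵐ z ∂μ, |g z| ≤ C) ∧
      ∀ h : α → ℝ, Integrable h μ →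
        Tendsto (fun i => ∫ z, φ i z * h z ∂μ) U (𝓝 (∫ z, g z * h z ∂μ)) := by
  classical
  let V : ι → Lp ℝ 2 μ := fun i => if h : MemLp (φ i) 2 μ then h.toLp (φ i) else 0
  have hmem : ∀ᶠ i in (U : Filter ι), MemLp (φ i) 2 μ := hφ.mono fun i hi =>
    MemLp.of_bound hi.1 C hi.2
  have hV : ∀ᶠ i in (U : Filter ι), V i =ᵐ[μ] φ i := hmem.mono fun i hi => by
    simp only [V, dif_pos hi]
    exact hi.coeFn_toLp
  let R : ℝ := (μ.real univ) ^ ((2 : ℝ≥0∞).toReal)⁻¹ * |C|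
  have hVR : ∀ᶠ i in (U : Filter ι), ‖V i‖ ≤ R := by
    filter_upwards [hφ, hV] with i hi hVi
    refine Lp.norm_le_of_ae_bound (abs_nonneg C) ?_
    filter_upwards [hi.2, hVi] with z hz hz'
    rw [hz', Real.norm_eq_abs]
    exact hz.trans (le_abs_self C)
  let X : ι → WeakDual ℝ (Lp ℝ 2 μ) := fun i =>
    StrongDual.toWeakDual (InnerProductSpace.toDual ℝ (Lp ℝ 2 μ) (V i))
  have hX : ((U.map X : Ultrafilter _) : Filter (WeakDual ℝ (Lp ℝ 2 μ))) ≤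
      𝓟 (WeakDual.toStrongDual ⁻¹' Metric.closedBall 0 R) := by
    rw [le_principal_iff]
    change ∀ᶠ i in (U : Filter ι), _
    filter_upwards [hVR] with i hi
    simpa [X] using hi
  obtain ⟨ℓ, -, hℓ⟩ := (WeakDual.isCompact_closedBall (𝕜 := ℝ) (E := Lp ℝ 2 μ) 0 R).ultrafilter_le_nhds _ hX
  let g : Lp ℝ 2 μ := (InnerProductSpace.toDual ℝ (Lp ℝ 2 μ)).symm (WeakDual.toStrongDual ℓ)
  have hlim : ∀ h : α → ℝ, MemLp h 2 μ →
      Tendsto (fun i => ∫ z, φ i z * h z ∂μ) U (𝓝 (∫ z, g z * h z ∂μ)) := by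
    intro h hh
    have h1 : Tendsto (fun i => X i (hh.toLp h)) U (𝓝 (ℓ (hh.toLp h))) :=
      ((WeakDual.eval_continuous (hh.toLp h)).tendsto ℓ).comp hℓ
    have h2 : ∀ v : Lp ℝ 2 μ, inner ℝ v (hh.toLp h) = ∫ z, v z * h z ∂μ := fun v => by
      rw [L2.inner_def]
      refine integral_congr_ae ?_
      filter_upwards [hh.coeFn_toLp] with z hz
      rw [hz]
      simp [mul_comm]
    have h3 : ℓ (hh.toLp h) = ∫ z, g z * h z ∂μ := by
      rw [← h2, InnerProductSpace.toDual_symm_apply]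
      rfl
    rw [← h3]
    refine h1.congr' ?_
    filter_upwards [hV] with i hi
    change inner ℝ (V i) (hh.toLp h) = _
    rw [h2]
    refine integral_congr_ae ?_
    filter_upwards [hi] with z hz
    rw [hz]
  have hgi : Integrable g μ := (Lp.memLp g).integrable (by norm_num)
  have hgm : AEStronglyMeasurable g μ := hgi.aestronglyMeasurable
  -- The weak limit keeps the bound `C` because its averages over measurable sets are limits of
  -- averages lying in `[-C, C]`.
  have hset : ∀ A : Set α, MeasurableSet A →
      Tendsto (fun i => ∫ z in A, φ i z ∂μ) U (𝓝 (∫ z in A, g z ∂μ)) := fun A hA => by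
    have := hlim (A.indicator fun _ => 1) (memLp_indicator_const 2 hA 1 (Or.inr (measure_ne_top _ _)))
    have e : ∀ ψ : α → ℝ, ∫ z, ψ z * A.indicator (fun _ => (1 : ℝ)) z ∂μ = ∫ z in A, ψ z ∂μ :=
      fun ψ => by
        rw [← integral_indicator hA]
        congr 1
        funext z
        by_cases hz : z ∈ A <;> simp [hz]
    simpa only [e] using this
  have hupper : (g : α → ℝ) ≤ᵐ[μ] fun _ => C := by
    refine ae_le_of_forall_setIntegral_le hgi (integrable_const C) fun A hA _ => ?_
    refine le_of_tendsto (hset A hA) ?_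
    filter_upwards [hφ, hmem] with i hi hi2
    refine integral_mono_ae (hi2.integrable (by norm_num)).integrableOn
      (integrable_const C) (ae_restrict_of_ae ?_)
    filter_upwards [hi.2] with z hz using (abs_le.1 hz).2
  have hlower : (fun _ => -C) ≤ᵐ[μ] (g : α → ℝ) := by
    refine ae_le_of_forall_setIntegral_le (integrable_const (-C)) hgi fun A hA _ => ?_
    refine ge_of_tendsto (hset A hA) ?_
    filter_upwards [hφ, hmem] with i hi hi2
    refine integral_mono_ae (integrable_const (-C))
      (hi2.integrable (by norm_num)).integrableOn (ae_restrict_of_ae ?_)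
    filter_upwards [hi.2] with z hz using (abs_le.1 hz).1
  have hgC : ∀ᵐ z ∂μ, |g z| ≤ C := by
    filter_upwards [hupper, hlower] with z h1 h2 using abs_le.2 ⟨h2, h1⟩
  exact ⟨g, hgm, hgC, fun h hh => tendsto_integral_mul_of_memLp_two hφ hgm hgC hlim hh⟩

/-- A bounded family that tends to zero in `L^2` tends to zero in `L^1` with any integrable
weight. -/
theorem tendsto_integral_abs_mul_of_sq [IsFiniteMeasure μ] {l : Filter ι} {w : ι → α → ℝ} {C : ℝ}
    (hw : ∀ᶠ i in l, AEStronglyMeasurable (w i) μ ∧ ∀ᵐ z ∂μ, |w i z| ≤ C)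
    (hw2 : Tendsto (fun i => ∫ z, (w i z) ^ 2 ∂μ) l (𝓝 0)) {k : α → ℝ} (hk : Integrable k μ) :
    Tendsto (fun i => ∫ z, |w i z| * k z ∂μ) l (𝓝 0) := by
  -- Cauchy–Schwarz handles weights in `L^2`; boundedness then extends the limit to weights in
  -- `L^1`, with `0` in the role of the weak limit.
  have key : Tendsto (fun i => ∫ z, |w i z| * k z ∂μ) l (𝓝 (∫ z, (0 : ℝ) * k z ∂μ)) := by
    refine tendsto_integral_mul_of_memLp_two (C := |C|) (g := fun _ => 0) ?_
      aestronglyMeasurable_const (Eventually.of_forall fun _ => by simp) ?_ hk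
    · filter_upwards [hw] with i hi
      refine ⟨by simpa using hi.1.norm, ?_⟩
      filter_upwards [hi.2] with z hz
      rw [abs_abs]
      exact hz.trans (le_abs_self C)
    · intro h hh
      simp only [zero_mul, integral_zero]
      have hlim : Tendsto (fun i => Real.sqrt (∫ z, (w i z) ^ 2 ∂μ) * Real.sqrt (∫ z, (h z) ^ 2 ∂μ))
          l (𝓝 0) := by
        have := (hw2.sqrt).mul_const (Real.sqrt (∫ z, (h z) ^ 2 ∂μ))
        simpa using this
      refine squeeze_zero_norm' ?_ hlim
      filter_upwards [hw] with i hi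
      have hwi : MemLp (w i) 2 μ := MemLp.of_bound hi.1 C hi.2
      have := integral_mul_norm_le_Lp_mul_Lq (μ := μ) (f := w i) (g := h) (p := 2) (q := 2)
        Real.HolderConjugate.two_two (by simpa using hwi) (by simpa using hh)
      calc ‖∫ z, |w i z| * h z ∂μ‖ ≤ ∫ z, ‖|w i z| * h z‖ ∂μ := norm_integral_le_integral_norm _
        _ = ∫ z, ‖w i z‖ * ‖h z‖ ∂μ := by simp
        _ ≤ _ := by simpa [Real.sqrt_eq_rpow] using this
  simpa using key

end WeakStar

/-! ### The weak form of an ordinary differential equation -/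

/-- For `ψ` supported in `(0,T)`, the primitive of `ψ` vanishing near `T` is an admissible test
function whose value at `0` is `-∫ ψ`. Fubini moves the primitive from `ψ` to `k`, leaving `∫ ψ (w -
c - K) = 0`; arbitrariness of `ψ` concludes. -/
theorem ae_eq_add_integral_of_weak {T c : ℝ} {w k : ℝ → ℝ}
    (hw : Integrable w (timeMeasure T)) (hk : Integrable k (timeMeasure T))
    (h : ∀ η : ℝ → ℝ, ContDiff ℝ ((⊤ : ℕ∞) : WithTop ℕ∞) η → (∃ b < T, ∀ t, b ≤ t → η t = 0) →
      ∫ t, (w t * deriv η t + k t * η t) ∂(timeMeasure T) = -(c * η 0)) :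
    ∀ᵐ t ∂(timeMeasure T), w t = c + ∫ s in Icc 0 t, k s := by
  set K : ℝ → ℝ := fun t => ∫ s in Icc 0 t, k s with hK
  have hKi : Integrable K (timeMeasure T) :=
    (intervalIntegral.continuousOn_primitive_Icc hk).integrableOn_Icc
  have hei : Integrable (fun t => w t - c - K t) (timeMeasure T) :=
    (hw.sub (integrable_const c)).sub hKi
  have hmain : ∀ᵐ t, t ∈ Ioo 0 T → w t - c - K t = 0 := by
    refine isOpen_Ioo.ae_eq_zero_of_integral_contDiff_smul_eq_zero
      ((IntegrableOn.mono_set hei Ioo_subset_Icc_self).locallyIntegrableOn) ?_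
    intro ψ hψ hψc hψs
    have hψcont : Continuous ψ := hψ.continuous
    have hψi : Integrable ψ (timeMeasure T) :=
      (hψcont.integrable_of_hasCompactSupport hψc).integrableOn
    obtain ⟨B, hB⟩ := hψc.exists_bound_of_continuous hψcont
    have hψB : ∀ᵐ t ∂(timeMeasure T), ‖ψ t‖ ≤ B := Eventually.of_forall hB
    have hψm : AEStronglyMeasurable ψ (timeMeasure T) := hψi.aestronglyMeasurable
    have hzero : ∀ t, t ∉ Ioo 0 T → ψ t = 0 := fun t ht =>
      image_eq_zero_of_notMem_tsupport fun h' => ht (hψs h')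
    -- the primitive of `ψ` that vanishes near `T`
    set η : ℝ → ℝ := fun t => ∫ s in T..t, ψ s with hη
    have hηd : ∀ t, HasDerivAt η (ψ t) t := fun t =>
      intervalIntegral.integral_hasDerivAt_right (hψcont.intervalIntegrable _ _)
        (hψcont.stronglyMeasurableAtFilter _ _) hψcont.continuousAt
    have hηderiv : deriv η = ψ := funext fun t => (hηd t).deriv
    have hηs : ContDiff ℝ ((⊤ : ℕ∞) : WithTop ℕ∞) η := by
      rw [contDiff_infty_iff_deriv]
      exact ⟨fun t => (hηd t).differentiableAt, hηderiv ▸ hψ⟩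
    have hηb : ∃ b < T, ∀ t, b ≤ t → η t = 0 := by
      rcases (tsupport ψ).eq_empty_or_nonempty with he | hne
      · refine ⟨T - 1, by linarith, fun t _ => ?_⟩
        have : ψ = 0 := tsupport_eq_empty_iff.1 he
        simp [hη, this]
      -- The last point of the compact support of `ψ` lies strictly before `T`, and the primitive
      -- vanishes from there on.
      · obtain ⟨b, hb, hbmax⟩ := (HasCompactSupport.isCompact hψc).exists_isGreatest hne
        refine ⟨b, (hψs hb).2, fun t ht => ?_⟩
        have hz : ∀ s, b < s → ψ s = 0 := fun s hs =>
          image_eq_zero_of_notMem_tsupport fun h' => absurd (hbmax h') (not_le.2 hs)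
        rw [hη]
        refine intervalIntegral.integral_zero_ae (Eventually.of_forall fun s hs => hz s ?_)
        rcases le_total T t with h1 | h1
        · rw [uIoc_of_le h1] at hs
          exact (hψs hb).2.trans hs.1
        · rw [uIoc_of_ge h1] at hs
          exact ht.trans_lt hs.1
    have hηval : ∀ t ∈ Icc 0 T, η t = -∫ s in Icc 0 T, (Ici t).indicator ψ s := fun t ht => by
      have hI : Icc 0 T ∩ Ici t = Icc t T := by
        ext s
        exact ⟨fun hs => ⟨hs.2, hs.1.2⟩, fun hs => ⟨⟨ht.1.trans hs.1, hs.2⟩, hs.1⟩⟩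
      rw [setIntegral_indicator measurableSet_Ici, hI,
        integral_Icc_eq_integral_Ioc, ← intervalIntegral.integral_of_le ht.2,
        ← intervalIntegral.integral_symm]
    -- Fubini
    have hFub : ∫ t, k t * η t ∂(timeMeasure T) = -∫ s, ψ s * K s ∂(timeMeasure T) := by
      have hG : Integrable (Function.uncurry fun t s =>
          {p : ℝ × ℝ | p.1 ≤ p.2}.indicator (fun p => k p.1 * ψ p.2) (t, s))
          ((timeMeasure T).prod (timeMeasure T)) :=
        (hk.mul_prod hψi).indicator (measurableSet_le measurable_fst measurable_snd)
      have hswap := integral_integral_swap hG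
      have hl : ∫ t, k t * η t ∂(timeMeasure T) = -∫ t, ∫ s,
          {p : ℝ × ℝ | p.1 ≤ p.2}.indicator (fun p => k p.1 * ψ p.2) (t, s)
            ∂(timeMeasure T) ∂(timeMeasure T) := by
        rw [← integral_neg]
        refine setIntegral_congr_fun measurableSet_Icc fun t ht => ?_
        rw [hηval t ht, mul_neg, ← integral_const_mul]
        congr 2
        funext s
        by_cases hts : t ≤ s <;> simp [hts]
      rw [hl, hswap]
      congr 1
      refine setIntegral_congr_fun measurableSet_Icc fun s hs => ?_
      have : K s = ∫ t in Icc 0 T, (Iic s).indicator k t := by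
        have hI : Icc 0 T ∩ Iic s = Icc 0 s := by
          ext t
          exact ⟨fun ht => ⟨ht.1.1, ht.2⟩, fun ht => ⟨⟨ht.1, ht.2.trans hs.2⟩, ht.2⟩⟩
        rw [setIntegral_indicator measurableSet_Iic, hI]
      rw [this, ← integral_const_mul]
      congr 1
      funext t
      by_cases hts : t ≤ s <;> simp [hts, mul_comm]
    have hT0 : η 0 = -∫ s, ψ s ∂(timeMeasure T) := by
      rcases le_or_gt 0 T with hT | hT
      · rw [integral_Icc_eq_integral_Ioc, ← intervalIntegral.integral_of_le hT,
          ← intervalIntegral.integral_symm]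
      · have : ψ = 0 := funext fun t => hzero t (by simp [Ioo_eq_empty (not_lt.2 hT.le)])
        simp [hη, this]
    have hηi : Integrable (fun t => k t * η t) (timeMeasure T) := by
      have hc : Continuous η := hηs.continuous
      exact IntegrableOn.mul_continuousOn hk hc.continuousOn isCompact_Icc
    have hwi : Integrable (fun t => ψ t * w t) (timeMeasure T) := hw.bdd_mul hψm hψB
    have hKψ : Integrable (fun t => ψ t * K t) (timeMeasure T) := hKi.bdd_mul hψm hψB
    have hweak := h η hηs hηb
    rw [hηderiv, hT0] at hweak
    simp only [mul_comm (w _)] at hweak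
    rw [integral_add hwi hηi, hFub] at hweak
    have hset : ∫ t, ψ t • (w t - c - K t) = ∫ t, ψ t • (w t - c - K t) ∂(timeMeasure T) := by
      refine (setIntegral_eq_integral_of_forall_compl_eq_zero fun t ht => ?_).symm
      rw [hzero t fun h' => ht (Ioo_subset_Icc_self h'), zero_smul]
    have hexp : ∀ t, ψ t • (w t - c - K t) = ψ t * w t - ψ t * c - ψ t * K t := fun t => by
      rw [smul_eq_mul]; ring
    rw [hset]
    simp only [hexp]
    have i2 : Integrable (fun t => ψ t * w t - ψ t * c) (timeMeasure T) :=
      hwi.sub (hψi.mul_const c)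
    rw [integral_sub i2 hKψ, integral_sub hwi (hψi.mul_const c), integral_mul_const]
    linarith
  have hae : ∀ᵐ t ∂(volume.restrict (Ioo 0 T)), w t - c - K t = 0 :=
    (ae_restrict_iff' measurableSet_Ioo).2 hmain
  rw [timeMeasure, ← Measure.restrict_congr_set (Ioo_ae_eq_Icc (μ := volume))]
  filter_upwards [hae] with t ht
  linarith

/-! ### Mixed norms -/

section Mixed

variable {d : ℕ} {E : Type*} [NormedAddCommGroup E] {T : ℝ}

theorem mixedNorm_self {f : ℝ → Torus d → E}
    (hf : AEStronglyMeasurable (fun z : ℝ × Torus d => f z.1 z.2) (spaceTime d T))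
    {p : ℝ≥0∞} (hp0 : p ≠ 0) (hp : p ≠ ∞) :
    mixedNorm T p p f = eLpNorm (fun z : ℝ × Torus d => f z.1 z.2) p (spaceTime d T) := by
  have hpos : 0 < p.toReal := ENNReal.toReal_pos hp0 hp
  rw [mixedNorm, eLpNorm_eq_lintegral_rpow_enorm_toReal hp0 hp,
    eLpNorm_eq_lintegral_rpow_enorm_toReal hp0 hp, lintegral_prod _ (hf.enorm.pow_const _)]
  congr 2
  funext t
  rw [eLpNorm_eq_lintegral_rpow_enorm_toReal hp0 hp, enorm_eq_self, ← ENNReal.rpow_mul,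
    one_div_mul_cancel hpos.ne', ENNReal.rpow_one]

theorem memMixed_one_iff {f : ℝ → Torus d → E} :
    MemMixed T 1 1 f ↔ Integrable (fun z : ℝ × Torus d => f z.1 z.2) (spaceTime d T) := by
  rw [← memLp_one_iff_integrable]
  constructor
  · rintro ⟨hm, hn⟩
    exact ⟨hm, by rwa [← mixedNorm_self hm (by simp) (by simp)]⟩
  · rintro ⟨hm, hn⟩
    exact ⟨hm, by rwa [mixedNorm_self hm (by simp) (by simp)]⟩

/-- Slice-wise null sets assemble into a null set of the product when the set is measurable, hence
the detour through a strongly measurable representative. -/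
theorem ae_norm_le_of_ae_ae {f : ℝ → Torus d → E}
    (hf : AEStronglyMeasurable (fun z : ℝ × Torus d => f z.1 z.2) (spaceTime d T)) {C : ℝ}
    (h : ∀ᵐ t ∂(timeMeasure T), ∀ᵐ x : Torus d, ‖f t x‖ ≤ C) :
    ∀ᵐ z ∂(spaceTime d T), ‖f z.1 z.2‖ ≤ C := by
  have h1 : ∀ᵐ z ∂(spaceTime d T), ‖hf.mk _ z‖ ≤ C := by
    have hms : MeasurableSet {z | ‖hf.mk _ z‖ ≤ C} :=
      hf.stronglyMeasurable_mk.norm.measurable measurableSet_Iic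
    refine (Measure.ae_prod_iff_ae_ae hms).2 ?_
    filter_upwards [h, Measure.ae_ae_of_ae_prod hf.ae_eq_mk] with t ht ht'
    filter_upwards [ht, ht'] with x hx hx'
    rwa [← hx']
  filter_upwards [h1, hf.ae_eq_mk] with z hz hz'
  rwa [hz']

theorem ae_norm_le_of_eLpNorm_top_le {α : Type*} [MeasurableSpace α] {μ : Measure α} {f : α → E}
    {C : ℝ} (hC : 0 ≤ C) (h : eLpNorm f ∞ μ ≤ ENNReal.ofReal C) : ∀ᵐ x ∂μ, ‖f x‖ ≤ C := by
  rw [eLpNorm_exponent_top] at h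
  filter_upwards [enorm_ae_le_eLpNormEssSup f μ] with x hx
  have := hx.trans h
  rwa [← ofReal_norm, ENNReal.ofReal_le_ofReal_iff hC] at this

theorem MemMixed.exists_bound {f : ℝ → Torus d → E} (hf : MemMixed T ∞ ∞ f) :
    ∃ C, 0 ≤ C ∧ ∀ᵐ z ∂(spaceTime d T), ‖f z.1 z.2‖ ≤ C := by
  refine ⟨(mixedNorm T ∞ ∞ f).toReal, ENNReal.toReal_nonneg, ae_norm_le_of_ae_ae hf.1 ?_⟩
  filter_upwards [enorm_ae_le_eLpNormEssSup (fun t => eLpNorm (f t) ∞ volume) (timeMeasure T)]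
    with t ht
  refine ae_norm_le_of_eLpNorm_top_le ENNReal.toReal_nonneg ?_
  rw [ENNReal.ofReal_toReal hf.2.ne, mixedNorm, eLpNorm_exponent_top]
  simpa using ht

theorem memMixed_of_bound {f : ℝ → Torus d → E}
    (hf : AEStronglyMeasurable (fun z : ℝ × Torus d => f z.1 z.2) (spaceTime d T)) {C : ℝ}
    (hC : ∀ᵐ z ∂(spaceTime d T), ‖f z.1 z.2‖ ≤ C) (p q : ℝ≥0∞) : MemMixed T p q f := by
  refine ⟨hf, ?_⟩
  have h : ∀ᵐ t ∂(timeMeasure T), ‖eLpNorm (f t) q volume‖ₑ ≤ ‖ENNReal.ofReal C‖ₑ := by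
    filter_upwards [Measure.ae_ae_of_ae_prod hC] with t ht
    rw [enorm_eq_self, enorm_eq_self]
    refine (eLpNorm_le_of_ae_bound ht).trans ?_
    simp
  exact (eLpNorm_mono_enorm_ae h).trans_lt (memLp_const_enorm (by simp)).2

/-- Interpolation between `L^1` and `L^∞`: `|w|^p ≤ |M|^(p-1) |w|`. It upgrades `L^1` convergence of
bounded families to all finite `p`. -/
theorem eLpNorm_le_of_bound_of_integral {α : Type*} [MeasurableSpace α] {μ : Measure α}
    {w : α → ℝ} (hw : Integrable w μ) {M : ℝ} (hM : ∀ᵐ x ∂μ, |w x| ≤ M) {p : ℝ≥0∞}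
    (hp1 : 1 ≤ p) (hp : p ≠ ∞) {I : ℝ} (hI : ∫ x, |w x| ∂μ ≤ I) :
    eLpNorm w p μ ≤ ENNReal.ofReal ((|M| ^ (p.toReal - 1) * I) ^ (1 / p.toReal)) := by
  have hp0 : p ≠ 0 := (zero_lt_one.trans_le hp1).ne'
  have hr1 : 1 ≤ p.toReal := by
    simpa using (ENNReal.toReal_le_toReal (by simp) hp).2 hp1
  have hI0 : 0 ≤ I := (integral_nonneg fun _ => abs_nonneg _).trans hI
  have hM0 : 0 ≤ |M| ^ (p.toReal - 1) := by positivity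
  rw [eLpNorm_eq_lintegral_rpow_enorm_toReal hp0 hp,
    ← ENNReal.ofReal_rpow_of_nonneg (by positivity) (by positivity)]
  refine ENNReal.rpow_le_rpow ?_ (by positivity)
  calc ∫⁻ x, ‖w x‖ₑ ^ p.toReal ∂μ
      ≤ ∫⁻ x, ENNReal.ofReal (|M| ^ (p.toReal - 1) * |w x|) ∂μ := by
        refine lintegral_mono_ae ?_
        filter_upwards [hM] with x hx
        rw [← ofReal_norm, ENNReal.ofReal_rpow_of_nonneg (norm_nonneg _) (by positivity)]
        refine ENNReal.ofReal_le_ofReal ?_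
        rw [Real.norm_eq_abs]
        calc |w x| ^ p.toReal = |w x| ^ (p.toReal - 1) * |w x| := by
              rcases eq_or_ne (w x) 0 with h0 | h0
              · simp [h0, (zero_lt_one.trans_le hr1).ne']
              · rw [Real.rpow_sub_one (abs_pos.2 h0).ne',
                  div_mul_cancel₀ _ (abs_pos.2 h0).ne']
          _ ≤ _ := mul_le_mul_of_nonneg_right (Real.rpow_le_rpow (abs_nonneg _)
              (hx.trans (le_abs_self M)) (by linarith)) (abs_nonneg _)
    _ = ENNReal.ofReal (∫ x, |M| ^ (p.toReal - 1) * |w x| ∂μ) := by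
        rw [ofReal_integral_eq_lintegral_ofReal (hw.abs.const_mul _)]
        exact Eventually.of_forall fun x => mul_nonneg hM0 (abs_nonneg _)
    _ ≤ _ := by
        rw [integral_const_mul]
        exact ENNReal.ofReal_le_ofReal (mul_le_mul_of_nonneg_left hI hM0)

theorem tendsto_interpolation_bound (M : ℝ) {p : ℝ≥0∞} (hp1 : 1 ≤ p) (hp : p ≠ ∞) :
    Tendsto (fun I : ℝ => ENNReal.ofReal ((|M| ^ (p.toReal - 1) * I) ^ (1 / p.toReal)))
      (𝓝 0) (𝓝 0) := by
  have hpos : 0 < p.toReal := ENNReal.toReal_pos (zero_lt_one.trans_le hp1).ne' hp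
  have hc : Continuous (fun I : ℝ => (|M| ^ (p.toReal - 1) * I) ^ (1 / p.toReal)) :=
    (continuous_const.mul continuous_id).rpow_const fun _ => Or.inr (by positivity)
  have := (ENNReal.continuous_ofReal.comp hc).tendsto 0
  have h0 : (1 / p.toReal) ≠ 0 := by positivity
  simpa [Function.comp_def, Real.zero_rpow h0, Real.zero_rpow (inv_ne_zero hpos.ne')] using this

end Mixed

theorem integral_sq_le_of_eLpNorm_le {α : Type*} [MeasurableSpace α] {μ : Measure α}
    {g h : α → ℝ} (hg : MemLp g 2 μ) (hh : MemLp h 2 μ) (hle : eLpNorm g 2 μ ≤ eLpNorm h 2 μ) :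
    ∫ x, (g x) ^ 2 ∂μ ≤ ∫ x, (h x) ^ 2 ∂μ := by
  have hI : ∀ k : α → ℝ, 0 ≤ ∫ x, (k x) ^ 2 ∂μ := fun k => integral_nonneg fun x => sq_nonneg _
  rw [hg.eLpNorm_eq_integral_rpow_norm (by simp) (by simp),
    hh.eLpNorm_eq_integral_rpow_norm (by simp) (by simp)] at hle
  simp only [ENNReal.toReal_ofNat, Real.rpow_ofNat, Real.norm_eq_abs, sq_abs] at hle
  rw [ENNReal.ofReal_le_ofReal_iff (Real.rpow_nonneg (hI h) _),
    Real.rpow_le_rpow_iff (hI g) (hI h) (by norm_num)] at hle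
  exact hle

theorem integral_abs_le_sqrt {α : Type*} [MeasurableSpace α] {μ : Measure α}
    [IsProbabilityMeasure μ] {w : α → ℝ} (hw : MemLp w 2 μ) :
    ∫ x, |w x| ∂μ ≤ Real.sqrt (∫ x, (w x) ^ 2 ∂μ) := by
  have := integral_mul_norm_le_Lp_mul_Lq (μ := μ) (f := w) (g := fun _ => (1 : ℝ)) (p := 2) (q := 2)
    Real.HolderConjugate.two_two (by simpa using hw) (by simpa using memLp_const (1 : ℝ))
  simpa [Real.sqrt_eq_rpow] using this

/-- The weak form of `dA/dt = B` in separated variables gives the integrated form for almost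
every time. -/
theorem ae_integral_slice_eq_of_weak {d : ℕ} {T c : ℝ} {A B : ℝ × Torus d → ℝ}
    (hA : Integrable A (spaceTime d T)) (hB : Integrable B (spaceTime d T))
    (h : ∀ η : ℝ → ℝ, ContDiff ℝ ((⊤ : ℕ∞) : WithTop ℕ∞) η → (∃ b < T, ∀ t, b ≤ t → η t = 0) →
      ∫ z, (A z * deriv η z.1 + B z * η z.1) ∂(spaceTime d T) = -(c * η 0)) :
    ∀ᵐ t ∂(timeMeasure T), ∫ x, A (t, x) = c + ∫ s in Icc 0 t, ∫ x, B (s, x) := by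
  refine ae_eq_add_integral_of_weak hA.integral_prod_left hB.integral_prod_left ?_
  intro η hη hηb
  rw [← h η hη hηb]
  have hbd : ∀ k : ℝ → ℝ, Continuous k → ∀ {G : ℝ × Torus d → ℝ}, Integrable G (spaceTime d T) →
      Integrable (fun z => G z * k z.1) (spaceTime d T) := by
    intro k hk G hG
    obtain ⟨b, -, hb⟩ := exists_bound_of_continuous (d := d) T (hk.comp continuous_fst)
    exact hG.mul_bdd (hk.comp continuous_fst).aestronglyMeasurable hb
  have h1 := hbd _ (hη.continuous_deriv (by simp)) hA
  have h2 := hbd _ hη.continuous hB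
  have h3 : Integrable (fun z => A z * deriv η z.1 + B z * η z.1) (spaceTime d T) := h1.add h2
  rw [integral_prod _ h3]
  refine integral_congr_ae ?_
  filter_upwards [h1.prod_right_ae, h2.prod_right_ae] with t ht1 ht2
  rw [← integral_mul_const, ← integral_mul_const, ← integral_add ht1 ht2]

/-! ### Weak-* convergence -/

section Convergence

variable {d : ℕ} {T : ℝ} {u : ℝ → Torus d → EuclideanSpace ℝ (Fin d)}

theorem integrable_of_continuous {Φ : ℝ × Torus d → ℝ} (hΦ : Continuous Φ) :
    Integrable Φ (spaceTime d T) := by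
  obtain ⟨B, -, hB⟩ := exists_bound_of_continuous T hΦ
  exact Integrable.of_bound hΦ.aestronglyMeasurable B hB

theorem integrable_inner_grad (hu : MemMixed T 1 1 u) {φ : ℝ → Torus d → ℝ} (hφ : IsSmooth φ) :
    Integrable (fun z : ℝ × Torus d => inner ℝ (u z.1 z.2) (grad (φ z.1) z.2))
      (spaceTime d T) := by
  have hu' := memMixed_one_iff.1 hu
  obtain ⟨B, -, hB⟩ := exists_bound_of_continuous T hφ.continuous_grad
  refine (hu'.norm.mul_const B).mono'
    (hu'.aestronglyMeasurable.inner hφ.continuous_grad.aestronglyMeasurable) ?_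
  filter_upwards [hB] with z hz
  exact (norm_inner_le_norm _ _).trans (mul_le_mul_of_nonneg_left hz (norm_nonneg _))

theorem integrable_transport (hu : MemMixed T 1 1 u) {φ : ℝ → Torus d → ℝ} (hφ : IsSmooth φ) :
    Integrable (fun z : ℝ × Torus d =>
      timeDeriv φ z.1 z.2 + inner ℝ (u z.1 z.2) (grad (φ z.1) z.2)) (spaceTime d T) :=
  (integrable_of_continuous hφ.timeDeriv.continuous).add (integrable_inner_grad hu hφ)

/-- Testing convergence on ultrafilters replaces the extraction of subsequences: each has some
weak-* limit, and uniqueness identifies all of them with `f`. -/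
theorem tendsto_weakStar_of_unique (hu : MemMixed T 1 1 u) {f₀ : Torus d → ℝ}
    {f : ℝ → Torus d → ℝ} (huniq : IsUniqueBoundedSolTE T u f₀ f)
    {F : ℝ → ℝ → Torus d → ℝ} (hF : ∀ ν > 0, IsWeakSolADE T ν u f₀ (F ν)) {C : ℝ}
    (hFC : ∀ ν > 0, ∀ᵐ z ∂(spaceTime d T), |F ν z.1 z.2| ≤ C)
    {h : ℝ × Torus d → ℝ} (hh : Integrable h (spaceTime d T)) :
    Tendsto (fun ν => ∫ z, F ν z.1 z.2 * h z ∂(spaceTime d T)) (𝓝[>] 0)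
      (𝓝 (∫ z, f z.1 z.2 * h z ∂(spaceTime d T))) := by
  rw [tendsto_iff_ultrafilter]
  intro U hU
  have hpos : ∀ᶠ ν in (U : Filter ℝ), 0 < ν := hU self_mem_nhdsWithin
  have hU0 : Tendsto (fun ν : ℝ => ν) U (𝓝 0) := hU.trans nhdsWithin_le_nhds
  have hFU : ∀ᶠ ν in (U : Filter ℝ),
      AEStronglyMeasurable (fun z : ℝ × Torus d => F ν z.1 z.2) (spaceTime d T) ∧
        ∀ᵐ z ∂(spaceTime d T), |F ν z.1 z.2| ≤ C :=
    hpos.mono fun ν hν => ⟨(hF ν hν).mem.1, hFC ν hν⟩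
  obtain ⟨g, hgm, hgC, hg⟩ := exists_weakStar_limit U hFU
  have hgmem : ∀ p q, MemMixed T p q fun t x => g (t, x) := memMixed_of_bound hgm hgC
  have hsol : IsWeakSolTE T u f₀ fun t x => g (t, x) := by
    refine ⟨hgmem 1 1, ?_, huniq.2.1.mem_init, ?_⟩
    · rw [memMixed_one_iff]
      exact (memMixed_one_iff.1 hu).bdd_smul C hgm hgC
    · intro φ hφ
      have hlap : Integrable (fun z : ℝ × Torus d => laplacian (φ z.1) z.2) (spaceTime d T) :=
        integrable_of_continuous hφ.1.laplacian.continuous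
      -- The integral converges to a finite limit along `U`, so the factor `ν` kills it.
      have hvisc : Tendsto (fun ν => ν * ∫ z, F ν z.1 z.2 * laplacian (φ z.1) z.2
          ∂(spaceTime d T)) U (𝓝 0) := by
        have := hU0.mul (hg _ hlap)
        simpa using this
      have h1 : Tendsto (fun ν => ∫ z, F ν z.1 z.2 *
          (timeDeriv φ z.1 z.2 + inner ℝ (u z.1 z.2) (grad (φ z.1) z.2)) ∂(spaceTime d T)) U
          (𝓝 (-∫ x, f₀ x * φ 0 x)) := by
        have h2 : Tendsto (fun ν => (-∫ x, f₀ x * φ 0 x) -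
            ν * ∫ z, F ν z.1 z.2 * laplacian (φ z.1) z.2 ∂(spaceTime d T)) U
            (𝓝 (-∫ x, f₀ x * φ 0 x)) := by
          simpa using hvisc.const_sub (-∫ x, f₀ x * φ 0 x)
        refine h2.congr' ?_
        filter_upwards [hpos, hFU] with ν hν hνb
        rw [← (hF ν hν).weak_eq φ hφ, ← integral_const_mul, ← integral_sub]
        · congr 1
          funext z
          ring
        · exact Integrable.bdd_mul_ae ((integrable_transport hu hφ.1).add (hlap.const_mul ν))
            hνb.1 hνb.2
        · exact (Integrable.bdd_mul_ae hlap hνb.1 hνb.2).const_mul ν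
      exact tendsto_nhds_unique (hg _ (integrable_transport hu hφ.1)) h1
  have hgf := huniq.2.2 _ (hgmem ∞ ∞) hsol
  have hint : ∫ z, f z.1 z.2 * h z ∂(spaceTime d T) = ∫ z, g z * h z ∂(spaceTime d T) := by
    refine integral_congr_ae ?_
    filter_upwards [hgf] with z hz
    rw [← hz]
  rw [hint]
  exact hg h hh

/-! ### Conservation of energy for renormalised solutions -/

/-- The bounded continuous function `s ↦ min(|s|, C)^2`. -/
noncomputable def truncatedSq (C : ℝ) : ℝ →ᵇ ℝ :=
  BoundedContinuousFunction.ofNormedAddCommGroup (fun s => (min |s| C) ^ 2) (by fun_prop)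
    (C ^ 2 + 1) fun s => by
      rw [Real.norm_eq_abs, abs_of_nonneg (sq_nonneg _)]
      rcases le_total 0 C with hC | hC
      · have h0 : 0 ≤ min |s| C := le_min (abs_nonneg _) hC
        have := pow_le_pow_left₀ h0 (min_le_right |s| C) 2
        linarith
      · rw [min_eq_right (hC.trans (abs_nonneg s))]
        linarith

theorem truncatedSq_apply {C s : ℝ} (h : |s| ≤ C) : truncatedSq C s = s ^ 2 := by
  change (min |s| C) ^ 2 = s ^ 2
  rw [min_eq_left h, sq_abs]

/-- Test functions of time alone have zero gradient, so the flux drops out and `∫ β(f(t))` is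
constant in time. Below the level `C` the truncated square is the square. -/
theorem IsRenormalised.ae_integral_sq {f₀ : Torus d → ℝ} {f : ℝ → Torus d → ℝ}
    (hren : IsRenormalised T u f₀ f) {C : ℝ}
    (hfC : ∀ᵐ z ∂(spaceTime d T), |f z.1 z.2| ≤ C) (hf₀C : ∀ᵐ x : Torus d, |f₀ x| ≤ C) :
    ∀ᵐ t ∂(timeMeasure T), ∫ x, (f t x) ^ 2 = ∫ x, (f₀ x) ^ 2 := by
  have hsol := hren.2 (truncatedSq C)
  have h0 : ∫ x, truncatedSq C (f₀ x) = ∫ x, (f₀ x) ^ 2 := by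
    refine integral_congr_ae ?_
    filter_upwards [hf₀C] with x hx using truncatedSq_apply hx
  have key := ae_integral_slice_eq_of_weak (c := ∫ x, truncatedSq C (f₀ x)) (B := fun _ => 0)
    (memMixed_one_iff.1 hsol.mem) (integrable_zero _ _ (spaceTime d T)) ?_
  · filter_upwards [key, Measure.ae_ae_of_ae_prod hfC] with t ht htC
    have h1 : ∫ x, truncatedSq C (f t x) = ∫ x, (f t x) ^ 2 := by
      refine integral_congr_ae ?_
      filter_upwards [htC] with x hx using truncatedSq_apply hx
    rw [← h1, ← h0]
    simpa using ht
  · intro η hη hηb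
    obtain ⟨b, hb, hηb⟩ := hηb
    have hw := hsol.weak_eq (fun t _ => η t) ⟨hη.comp contDiff_fst, b, hb, fun t ht _ => hηb t ht⟩
    have hg : ∀ (c : ℝ) (x : Torus d), grad (fun _ => c) x = 0 := fun c x => by
      ext i
      simp [grad, partialDeriv]
    simp only [timeDeriv, hg, inner_zero_right, add_zero] at hw
    simp only [zero_mul, add_zero]
    rw [hw, integral_mul_const]

/-! ### Strong convergence -/

theorem memLp_two_of_bound {α : Type*} [MeasurableSpace α] {μ : Measure α} [IsFiniteMeasure μ]
    {a : α → ℝ} {C : ℝ} (ham : AEStronglyMeasurable a μ) (ha : ∀ᵐ x ∂μ, |a x| ≤ C) :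
    MemLp a 2 μ := MemLp.of_bound ham C ha

theorem integral_sub_sq {α : Type*} [MeasurableSpace α] {μ : Measure α} {a b : α → ℝ}
    (ha : MemLp a 2 μ) (hb : MemLp b 2 μ) :
    ∫ x, (a x - b x) ^ 2 ∂μ =
      ∫ x, (a x) ^ 2 ∂μ - 2 * ∫ x, a x * b x ∂μ + ∫ x, (b x) ^ 2 ∂μ := by
  have hab : Integrable (fun x => 2 * (a x * b x)) μ := (ha.integrable_mul hb).const_mul 2
  have hd : Integrable (fun x => (a x) ^ 2 - 2 * (a x * b x)) μ := ha.integrable_sq.sub hab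
  rw [← integral_const_mul, ← integral_sub ha.integrable_sq hab,
    ← integral_add hd hb.integrable_sq]
  congr 1
  funext x
  ring

/-- Expanding the square and using the norm inequality gives `‖φ - f‖² ≤ 2‖f‖² - 2⟨φ, f⟩`, whose
right side tends to zero by weak convergence. -/
theorem tendsto_integral_sub_sq {α ι : Type*} [MeasurableSpace α] {μ : Measure α} {l : Filter ι}
    {φ : ι → α → ℝ} {f : α → ℝ} (hφ : ∀ᶠ i in l, MemLp (φ i) 2 μ) (hf : MemLp f 2 μ)
    (hweak : Tendsto (fun i => ∫ z, φ i z * f z ∂μ) l (𝓝 (∫ z, f z * f z ∂μ)))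
    (hnorm : ∀ᶠ i in l, ∫ z, (φ i z) ^ 2 ∂μ ≤ ∫ z, (f z) ^ 2 ∂μ) :
    Tendsto (fun i => ∫ z, (φ i z - f z) ^ 2 ∂μ) l (𝓝 0) := by
  have hlim : Tendsto (fun i => 2 * ∫ z, (f z) ^ 2 ∂μ - 2 * ∫ z, φ i z * f z ∂μ) l (𝓝 0) := by
    have := (hweak.const_mul 2).const_sub (2 * ∫ z, (f z) ^ 2 ∂μ)
    simpa [← pow_two] using this
  refine tendsto_of_tendsto_of_tendsto_of_le_of_le' tendsto_const_nhds hlim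
    (Eventually.of_forall fun i => integral_nonneg fun _ => sq_nonneg _) ?_
  filter_upwards [hφ, hnorm] with i hi hn
  rw [integral_sub_sq hi hf]
  linarith

theorem integral_sq_le_of_slices {a b : ℝ → Torus d → ℝ}
    (ha : MemLp (fun z : ℝ × Torus d => a z.1 z.2) 2 (spaceTime d T))
    (hb : MemLp (fun z : ℝ × Torus d => b z.1 z.2) 2 (spaceTime d T))
    (h : ∀ᵐ t ∂(timeMeasure T), ∫ x, (a t x) ^ 2 ≤ ∫ x, (b t x) ^ 2) :
    ∫ z, (a z.1 z.2) ^ 2 ∂(spaceTime d T) ≤ ∫ z, (b z.1 z.2) ^ 2 ∂(spaceTime d T) := by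
  rw [integral_prod _ ha.integrable_sq, integral_prod _ hb.integrable_sq]
  exact integral_mono_ae ha.integrable_sq.integral_prod_left hb.integrable_sq.integral_prod_left h

theorem tendstoMixed_self {F : ℝ → ℝ → Torus d → ℝ} {f : ℝ → Torus d → ℝ} {C : ℝ}
    (hFm : ∀ ν > 0, AEStronglyMeasurable (fun z : ℝ × Torus d => F ν z.1 z.2) (spaceTime d T))
    (hFC : ∀ ν > 0, ∀ᵐ z ∂(spaceTime d T), |F ν z.1 z.2| ≤ C)
    (hfm : AEStronglyMeasurable (fun z : ℝ × Torus d => f z.1 z.2) (spaceTime d T))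
    (hfC : ∀ᵐ z ∂(spaceTime d T), |f z.1 z.2| ≤ C)
    (h2 : Tendsto (fun ν => ∫ z, (F ν z.1 z.2 - f z.1 z.2) ^ 2 ∂(spaceTime d T)) (𝓝[>] 0) (𝓝 0))
    {p : ℝ≥0∞} (hp1 : 1 ≤ p) (hp : p ≠ ∞) : TendstoMixed T p p F f := by
  refine ⟨fun ν hν => memMixed_of_bound (hFm ν hν) (hFC ν hν) p p,
    memMixed_of_bound hfm hfC p p, ?_⟩
  have hwb : ∀ ν > 0, ∀ᵐ z ∂(spaceTime d T), |F ν z.1 z.2 - f z.1 z.2| ≤ 2 * C := fun ν hν => by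
    filter_upwards [hFC ν hν, hfC] with z h1 h2
    exact (abs_sub _ _).trans (by linarith)
  have hpos : ∀ᶠ ν : ℝ in 𝓝[>] 0, 0 < ν := self_mem_nhdsWithin
  have hL1 : Tendsto (fun ν => ∫ z, |F ν z.1 z.2 - f z.1 z.2| ∂(spaceTime d T))
      (𝓝[>] 0) (𝓝 0) := by
    have := tendsto_integral_abs_mul_of_sq (C := 2 * C)
      (hpos.mono fun ν hν => ⟨(hFm ν hν).sub hfm, hwb ν hν⟩) h2 (integrable_const (1 : ℝ))
    simpa using this
  refine tendsto_of_tendsto_of_tendsto_of_le_of_le' tendsto_const_nhds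
    ((tendsto_interpolation_bound (2 * C) hp1 hp).comp hL1)
    (Eventually.of_forall fun _ => bot_le) ?_
  filter_upwards [hpos] with ν hν
  have hm : AEStronglyMeasurable (fun z : ℝ × Torus d => F ν z.1 z.2 - f z.1 z.2)
    (spaceTime d T) := (hFm ν hν).sub hfm
  rw [mixedNorm_self (f := fun t x => F ν t x - f t x) hm (zero_lt_one.trans_le hp1).ne' hp]
  exact eLpNorm_le_of_bound_of_integral (Integrable.of_bound hm (2 * C) (hwb ν hν)) (hwb ν hν)
    hp1 hp le_rfl

end Convergence

/-! ### Uniform convergence in time -/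

section Uniform

variable {d : ℕ} {T : ℝ} {u : ℝ → Torus d → EuclideanSpace ℝ (Fin d)}

theorem abs_setIntegral_integral_le {B : ℝ × Torus d → ℝ} (hB : Integrable B (spaceTime d T))
    {t : ℝ} (ht : t ∈ Icc 0 T) :
    |∫ s in Icc 0 t, ∫ x, B (s, x)| ≤ ∫ z, |B z| ∂(spaceTime d T) := by
  have hi : Integrable (fun s => ∫ x, |B (s, x)|) (timeMeasure T) := hB.abs.integral_prod_left
  calc |∫ s in Icc 0 t, ∫ x, B (s, x)| ≤ ∫ s in Icc 0 t, |∫ x, B (s, x)| :=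
        abs_integral_le_integral_abs
    _ ≤ ∫ s in Icc 0 t, ∫ x, |B (s, x)| := by
        have hsub : Icc 0 t ⊆ Icc 0 T := Icc_subset_Icc_right ht.2
        exact integral_mono (IntegrableOn.mono_set hB.integral_prod_left hsub).abs
          (IntegrableOn.mono_set hi hsub) fun s => abs_integral_le_integral_abs
    _ ≤ ∫ s, (∫ x, |B (s, x)|) ∂(timeMeasure T) :=
        setIntegral_mono_set hi
          (Eventually.of_forall fun s => integral_nonneg fun x => abs_nonneg _)
          (Icc_subset_Icc_right ht.2).eventuallyLE
    _ = _ := (integral_prod _ hB.abs).symm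

/-- The weak equation for the difference of a viscous and an inviscid solution with the same data,
in separated variables. -/
theorem integral_difference_weak (hu : MemMixed T 1 1 u) {f₀ : Torus d → ℝ} {ν : ℝ}
    {f F : ℝ → Torus d → ℝ} (hf : IsWeakSolTE T u f₀ f) (hF : IsWeakSolADE T ν u f₀ F) {C : ℝ}
    (hfC : ∀ᵐ z ∂(spaceTime d T), |f z.1 z.2| ≤ C)
    (hFC : ∀ᵐ z ∂(spaceTime d T), |F z.1 z.2| ≤ C) {h : Torus d → ℝ}
    (hh : IsSmooth fun _ : ℝ => h) {η : ℝ → ℝ} (hη : ContDiff ℝ ((⊤ : ℕ∞) : WithTop ℕ∞) η)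
    (hηb : ∃ b < T, ∀ t, b ≤ t → η t = 0) :
    ∫ z, ((F z.1 z.2 - f z.1 z.2) * h z.2 * deriv η z.1 +
      ((F z.1 z.2 - f z.1 z.2) * inner ℝ (u z.1 z.2) (grad h z.2) +
        ν * (F z.1 z.2 * laplacian h z.2)) * η z.1) ∂(spaceTime d T) = 0 := by
  obtain ⟨b, hb, hηb⟩ := hηb
  have hsm := isSmooth_mul hη hh
  have htest : IsTestHalfOpen T (fun t x => η t * h x) :=
    ⟨hsm, b, hb, fun t ht x => by simp only [hηb t ht, zero_mul]⟩
  have e1 := hf.weak_eq _ htest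
  have e2 := hF.weak_eq _ htest
  have i0 := integrable_transport hu hsm
  have il := (integrable_of_continuous (T := T) hsm.laplacian.continuous).const_mul ν
  have i1 := Integrable.bdd_mul_ae i0 hf.mem.1 hfC
  have i2 := Integrable.bdd_mul_ae (i0.add il) hF.mem.1 hFC
  simp only [Pi.add_apply, timeDeriv_mul_const, grad_const_mul, laplacian_const_mul,
    inner_smul_right] at i1 i2 e1 e2
  have e3 := (integral_sub i2 i1).trans (sub_eq_zero.2 (e2.trans e1.symm))
  rw [← e3]
  congr 1
  funext z
  ring

/-- The difference of a viscous and an inviscid solution with the same data, tested against a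
smooth function of space. -/
theorem ae_abs_integral_sub_mul_le (hu : MemMixed T 1 1 u) {f₀ : Torus d → ℝ} {ν : ℝ}
    {f F : ℝ → Torus d → ℝ} (hf : IsWeakSolTE T u f₀ f) (hF : IsWeakSolADE T ν u f₀ F) {C : ℝ}
    (hfC : ∀ᵐ z ∂(spaceTime d T), |f z.1 z.2| ≤ C)
    (hFC : ∀ᵐ z ∂(spaceTime d T), |F z.1 z.2| ≤ C) {h : Torus d → ℝ}
    (hh : IsSmooth fun _ : ℝ => h) :
    ∀ᵐ t ∂(timeMeasure T), |∫ x, (F t x - f t x) * h x| ≤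
      (∫ z, |F z.1 z.2 - f z.1 z.2| * |inner ℝ (u z.1 z.2) (grad h z.2)| ∂(spaceTime d T)) +
        |ν| * (C * ∫ z : ℝ × Torus d, |laplacian h z.2| ∂(spaceTime d T)) := by
  have hfm := hf.mem.1
  have hFm := hF.mem.1
  have hwm : AEStronglyMeasurable (fun z : ℝ × Torus d => F z.1 z.2 - f z.1 z.2)
    (spaceTime d T) := hFm.sub hfm
  have hwC : ∀ᵐ z ∂(spaceTime d T), |F z.1 z.2 - f z.1 z.2| ≤ 2 * C := by
    filter_upwards [hFC, hfC] with z h1 h2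
    exact (abs_sub _ _).trans (by linarith)
  have hhi : Integrable (fun z : ℝ × Torus d => h z.2) (spaceTime d T) :=
    integrable_of_continuous hh.continuous
  have hgi : Integrable (fun z : ℝ × Torus d => inner ℝ (u z.1 z.2) (grad h z.2))
    (spaceTime d T) := integrable_inner_grad hu (φ := fun _ => h) hh
  have hli : Integrable (fun z : ℝ × Torus d => laplacian h z.2) (spaceTime d T) :=
    integrable_of_continuous hh.laplacian.continuous
  have hA : Integrable (fun z : ℝ × Torus d => (F z.1 z.2 - f z.1 z.2) * h z.2) (spaceTime d T) :=
    Integrable.bdd_mul_ae hhi hwm hwC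
  have hB1 : Integrable (fun z : ℝ × Torus d =>
      (F z.1 z.2 - f z.1 z.2) * inner ℝ (u z.1 z.2) (grad h z.2)) (spaceTime d T) :=
    Integrable.bdd_mul_ae hgi hwm hwC
  have hB2 : Integrable (fun z : ℝ × Torus d => ν * (F z.1 z.2 * laplacian h z.2))
      (spaceTime d T) := (Integrable.bdd_mul_ae hli hFm hFC).const_mul ν
  have hB : Integrable (fun z : ℝ × Torus d =>
      (F z.1 z.2 - f z.1 z.2) * inner ℝ (u z.1 z.2) (grad h z.2) +
        ν * (F z.1 z.2 * laplacian h z.2)) (spaceTime d T) := hB1.add hB2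
  -- The constant is `0` because both solutions have the same initial data.
  have key := ae_integral_slice_eq_of_weak (c := 0) hA hB fun η hη hηb => by
    rw [zero_mul, neg_zero]
    exact integral_difference_weak hu hf hF hfC hFC hh hη hηb
  filter_upwards [key, ae_restrict_mem measurableSet_Icc] with t ht htT
  rw [ht, zero_add]
  -- Enlarging `[0,t]` to `[0,T]` removes the dependence on `t`; this is the source of uniformity in
  -- time.
  refine (abs_setIntegral_integral_le hB htT).trans ?_
  have h1 : Integrable (fun z : ℝ × Torus d =>
      |F z.1 z.2 - f z.1 z.2| * |inner ℝ (u z.1 z.2) (grad h z.2)|) (spaceTime d T) := by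
    simpa only [abs_mul] using hB1.abs
  have h2 : Integrable (fun z : ℝ × Torus d => |ν| * (C * |laplacian h z.2|))
      (spaceTime d T) := (hli.abs.const_mul C).const_mul |ν|
  rw [← integral_const_mul, ← integral_const_mul, ← integral_add h1 h2]
  refine integral_mono_ae hB.abs (h1.add h2) ?_
  filter_upwards [hFC] with z hz
  refine (abs_add_le _ _).trans ?_
  rw [abs_mul, abs_mul, abs_mul]
  exact add_le_add le_rfl (mul_le_mul_of_nonneg_left
    (mul_le_mul_of_nonneg_right hz (abs_nonneg _)) (abs_nonneg _))

theorem tendstoMixed_top {f₀ : Torus d → ℝ} (hu : MemMixed T 1 1 u)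
    {F : ℝ → ℝ → Torus d → ℝ} {f : ℝ → Torus d → ℝ} {C : ℝ} (hC : 0 ≤ C)
    (hf : IsWeakSolTE T u f₀ f) (hF : ∀ ν > 0, IsWeakSolADE T ν u f₀ (F ν))
    (hfC : ∀ᵐ z ∂(spaceTime d T), |f z.1 z.2| ≤ C)
    (hFC : ∀ ν > 0, ∀ᵐ z ∂(spaceTime d T), |F ν z.1 z.2| ≤ C)
    (henergy : ∀ ν > 0, ∀ᵐ t ∂(timeMeasure T), ∫ x, (F ν t x) ^ 2 ≤ ∫ x, (f t x) ^ 2)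
    (h2 : Tendsto (fun ν => ∫ z, (F ν z.1 z.2 - f z.1 z.2) ^ 2 ∂(spaceTime d T)) (𝓝[>] 0) (𝓝 0))
    (hcont : MemC0L1 T f) {p : ℝ≥0∞} (hp1 : 1 ≤ p) (hp : p ≠ ∞) : TendstoMixed T ∞ p F f := by
  have hfm := hf.mem.1
  have hpos : ∀ᶠ ν : ℝ in 𝓝[>] 0, 0 < ν := self_mem_nhdsWithin
  have hwm : ∀ ν > 0, AEStronglyMeasurable (fun z : ℝ × Torus d => F ν z.1 z.2 - f z.1 z.2)
    (spaceTime d T) := fun ν hν => (hF ν hν).mem.1.sub hfm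
  have hwC : ∀ ν > 0, ∀ᵐ z ∂(spaceTime d T), |F ν z.1 z.2 - f z.1 z.2| ≤ 2 * C := fun ν hν => by
    filter_upwards [hFC ν hν, hfC] with z h1 h2
    exact (abs_sub _ _).trans (by linarith)
  obtain ⟨g, hfg, hgi, hgc⟩ := hcont
  have huniform : ∀ ε > 0, ∀ᶠ ν in 𝓝[>] (0 : ℝ), ∀ᵐ t ∂(timeMeasure T), t ∈ Icc 0 T →
      ∫ x, (F ν t x - f t x) ^ 2 ≤ ε := by
    intro ε hε
    -- The property is local in time and stable under finite unions, so it suffices to find one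
    -- neighbourhood of each `s` on which a single smooth `h` serves all nearby slices.
    refine isCompact_Icc.induction_on (p := fun S => ∀ᶠ ν in 𝓝[>] (0 : ℝ),
      ∀ᵐ t ∂(timeMeasure T), t ∈ S → ∫ x, (F ν t x - f t x) ^ 2 ≤ ε) ?_ ?_ ?_ ?_
    · simp
    · intro S S' hS hS'
      filter_upwards [hS'] with ν hν
      filter_upwards [hν] with t ht hts using ht (hS hts)
    · intro S S' hS hS'
      filter_upwards [hS, hS'] with ν hν hν'
      filter_upwards [hν, hν'] with t ht ht' hts
      exact hts.elim ht ht'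
    · intro s hs
      -- Both `‖h - g(s)‖` and `‖g(t) - g(s)‖` in `L^1` will be at most `δ`, and `2 (C + 1) * 2 δ =
      -- ε / 4`.
      set δ : ℝ := ε / (16 * (C + 1)) with hδ
      have hδpos : 0 < δ := by positivity
      obtain ⟨h, hh, hgh⟩ := exists_smooth_integral_abs_sub_lt
        (memLp_one_iff_integrable.1 (hgi s hs)) hδpos
      have hhi : Integrable h volume := (hh.continuous_slice 0).integrable_of_hasCompactSupport
        (HasCompactSupport.of_compactSpace _)
      refine ⟨_, inter_mem self_mem_nhdsWithin
        ((hgc s hs).eventually (gt_mem_nhds (ENNReal.ofReal_pos.2 hδpos))), ?_⟩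
      have hlim : Tendsto (fun ν => (∫ z, |F ν z.1 z.2 - f z.1 z.2| *
          |inner ℝ (u z.1 z.2) (grad h z.2)| ∂(spaceTime d T)) +
          |ν| * (C * ∫ z : ℝ × Torus d, |laplacian h z.2| ∂(spaceTime d T)))
          (𝓝[>] 0) (𝓝 0) := by
        have h1 := tendsto_integral_abs_mul_of_sq (C := 2 * C)
          (hpos.mono fun ν hν => ⟨hwm ν hν, hwC ν hν⟩) h2 (integrable_inner_grad hu (φ := fun _ => h) hh).abs
        have h3 : Tendsto (fun ν : ℝ => |ν|) (𝓝[>] 0) (𝓝 0) := by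
          simpa using (continuous_abs.tendsto (0 : ℝ)).mono_left nhdsWithin_le_nhds
        simpa using h1.add (h3.mul_const
          (C * ∫ z : ℝ × Torus d, |laplacian h z.2| ∂(spaceTime d T)))
      filter_upwards [hpos, hlim.eventually (gt_mem_nhds (by positivity : 0 < ε / 4))] with ν hν hνε
      filter_upwards [ae_abs_integral_sub_mul_le hu hf (hF ν hν) hfC (hFC ν hν) hh, hfg,
        henergy ν hν, hfm.prodMk_left, (hF ν hν).mem.1.prodMk_left,
        Measure.ae_ae_of_ae_prod hfC, Measure.ae_ae_of_ae_prod (hFC ν hν)]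
        with t ht hfgt hen hfmt hFmt hfCt hFCt htS
      have hft2 : MemLp (f t) 2 volume := memLp_two_of_bound hfmt hfCt
      have hFt2 : MemLp (F ν t) 2 volume := memLp_two_of_bound hFmt hFCt
      have hfti : Integrable (f t) volume := Integrable.of_bound hfmt C hfCt
      have hwt : ∀ᵐ x, |F ν t x - f t x| ≤ 2 * C := by
        filter_upwards [hFCt, hfCt] with x h1 h2
        exact (abs_sub _ _).trans (by linarith)
      have hwmt : AEStronglyMeasurable (fun x => F ν t x - f t x) volume := hFmt.sub hfmt
      have hgti := memLp_one_iff_integrable.1 (hgi t htS.1)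
      have hgsi := memLp_one_iff_integrable.1 (hgi s hs)
      have hgts : ∫ x, |g t x - g s x| ≤ δ := by
        have hlt : eLpNorm (fun x => g t x - g s x) 1 volume < ENNReal.ofReal δ := htS.2
        rw [eLpNorm_one_eq_lintegral_enorm] at hlt
        have := integral_norm_eq_lintegral_enorm (hgti.sub hgsi).aestronglyMeasurable
        simp only [Real.norm_eq_abs, Pi.sub_apply] at this
        rw [this]
        exact ENNReal.toReal_le_of_le_ofReal hδpos.le hlt.le
      have hfh : ∫ x, |f t x - h x| ≤ 2 * δ := by
        have i1 : Integrable (fun x => |g t x - g s x|) volume := (hgti.sub hgsi).abs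
        have i2 : Integrable (fun x => |g s x - h x|) volume := (hgsi.sub hhi).abs
        calc ∫ x, |f t x - h x| ≤ ∫ x, (|g t x - g s x| + |g s x - h x|) := by
              refine integral_mono_ae (hfti.sub hhi).abs (i1.add i2) ?_
              filter_upwards [hfgt] with x hx
              rw [hx]
              exact abs_sub_le _ _ _
          _ = (∫ x, |g t x - g s x|) + ∫ x, |g s x - h x| := integral_add i1 i2
          _ ≤ 2 * δ := by linarith
      have hfhi : Integrable (fun x => f t x - h x) volume := hfti.sub hhi
      have hrest : |∫ x, (F ν t x - f t x) * (f t x - h x)| ≤ ε / 4 := by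
        refine (abs_integral_mul_le hwt hfhi).trans ?_
        calc 2 * C * ∫ x, |f t x - h x| ≤ 2 * (C + 1) * (2 * δ) := by
              gcongr
              linarith
          _ = ε / 4 := by
              rw [hδ]
              field_simp
              norm_num
      have hsplit : ∫ x, (F ν t x - f t x) * f t x =
          (∫ x, (F ν t x - f t x) * h x) + ∫ x, (F ν t x - f t x) * (f t x - h x) := by
        rw [← integral_add (Integrable.bdd_mul_ae hhi hwmt hwt)
          (Integrable.bdd_mul_ae hfhi hwmt hwt)]
        congr 1
        funext x
        ring
      have hexpand : ∫ x, (F ν t x - f t x) * f t x =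
          (∫ x, F ν t x * f t x) - ∫ x, (f t x) ^ 2 := by
        have i1 : Integrable (fun x => F ν t x * f t x) volume := hFt2.integrable_mul hft2
        rw [← integral_sub i1 hft2.integrable_sq]
        congr 1
        funext x
        ring
      -- By the energy inequality the left side is at most `-2 ∫ (F - f) f`, and the two pieces of
      -- `hsplit` are each at most `ε / 4` in absolute value.
      rw [integral_sub_sq hFt2 hft2]
      have h5 := abs_le.1 (ht.trans hνε.le)
      have h6 := abs_le.1 hrest
      linarith [h5.1, h6.1]
  refine ⟨fun ν hν => memMixed_of_bound (hF ν hν).mem.1 (hFC ν hν) ∞ p,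
    memMixed_of_bound hfm hfC ∞ p, ?_⟩
  rw [ENNReal.tendsto_nhds_zero]
  intro ε hε
  have hsq : Tendsto (fun r : ℝ => ENNReal.ofReal
      ((|2 * C| ^ (p.toReal - 1) * Real.sqrt r) ^ (1 / p.toReal))) (𝓝[>] 0) (𝓝 0) := by
    refine (tendsto_interpolation_bound (2 * C) hp1 hp).comp ?_
    simpa using (Real.continuous_sqrt.tendsto 0).mono_left nhdsWithin_le_nhds
  -- `r` is a tolerance for the squared `L^2` norm of a slice: it makes the `L^1` norm at most `√r`
  -- and then, by interpolation, the `L^p` norm less than `ε`.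
  obtain ⟨r, hr, hrpos⟩ := ((hsq.eventually (gt_mem_nhds hε)).and
    (self_mem_nhdsWithin : Ioi (0 : ℝ) ∈ 𝓝[>] 0)).exists
  filter_upwards [huniform r hrpos, hpos] with ν hν hν0
  rw [mixedNorm, eLpNorm_exponent_top]
  refine essSup_le_of_ae_le ε ?_
  filter_upwards [hν, ae_restrict_mem measurableSet_Icc, (hwm ν hν0).prodMk_left,
    Measure.ae_ae_of_ae_prod (hwC ν hν0)] with t ht htT hm hb
  rw [enorm_eq_self]
  refine le_trans ?_ hr.le
  exact eLpNorm_le_of_bound_of_integral (Integrable.of_bound hm (2 * C) hb) hb hp1 hp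
    ((integral_abs_le_sqrt (memLp_two_of_bound hm hb)).trans (Real.sqrt_le_sqrt (ht htT)))

end Uniform

end VanishingViscosity

open VanishingViscosity
theorem proposition3p1 (d : ℕ) (T : ℝ) (hT : 0 < T)
    (u : ℝ → Torus d → EuclideanSpace ℝ (Fin d))
    (hu : MemMixed T 1 1 u) (hdiv : IsDivFree T u)
    (f₀ : Torus d → ℝ) (hf₀ : MemLp f₀ ∞ volume)
    (f : ℝ → Torus d → ℝ)
    (huniq : IsUniqueBoundedSolTE T u f₀ f)
    (hren : IsRenormalised T u f₀ f)
    (F : ℝ → ℝ → Torus d → ℝ)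
    (hF : ∀ ν > 0, IsWeakSolADE T ν u f₀ (F ν))
    (hFcont : ∀ ν > 0, ∃ g, IsRepresentative T (F ν) g ∧
      WeakStarContinuous T g ∧ InitialLpInequality T f₀ g) :
    TendstoWeakStar T F f ∧
    (∀ p : ℝ≥0∞, 1 ≤ p → p ≠ ∞ → TendstoMixed T p p F f) ∧
    (MemC0L1 T f → ∀ p : ℝ≥0∞, 1 ≤ p → p ≠ ∞ → TendstoMixed T ∞ p F f) := by
  obtain ⟨C₁, hC₁, hfC₁⟩ := huniq.1.exists_bound
  let C₀ : ℝ := (eLpNorm f₀ ∞ volume).toReal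
  have hC₀ : 0 ≤ C₀ := ENNReal.toReal_nonneg
  have hC₀' : eLpNorm f₀ ∞ volume = ENNReal.ofReal C₀ := (ENNReal.ofReal_toReal hf₀.2.ne).symm
  -- One constant must dominate `f₀`, `f` and every `F ν`, since the same truncation level is used
  -- for `f` and its initial data.
  let C : ℝ := max C₀ C₁
  have hfm := huniq.2.1.mem.1
  have hFm := fun ν hν => (hF ν hν).mem.1
  have hpos : ∀ᶠ ν : ℝ in 𝓝[>] 0, 0 < ν := self_mem_nhdsWithin
  have hfC : ∀ᵐ z ∂(spaceTime d T), |f z.1 z.2| ≤ C :=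
    hfC₁.mono fun z hz => hz.trans (le_max_right _ _)
  have hf₀C : ∀ᵐ x, |f₀ x| ≤ C :=
    (ae_norm_le_of_eLpNorm_top_le hC₀ hC₀'.le).mono fun x hx => hx.trans (le_max_left _ _)
  have hFC : ∀ ν > 0, ∀ᵐ z ∂(spaceTime d T), |F ν z.1 z.2| ≤ C := fun ν hν => by
    obtain ⟨g, hg, -, hgL⟩ := hFcont ν hν
    refine ae_norm_le_of_ae_ae (hFm ν hν) ?_
    filter_upwards [hg, ae_restrict_mem measurableSet_Icc] with t ht htT
    have hb := ae_norm_le_of_eLpNorm_top_le hC₀ ((hgL ∞ le_top t htT).trans hC₀'.le)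
    filter_upwards [ht, hb] with x hx hxb
    rw [hx]
    exact hxb.trans (le_max_left _ _)
  have hf₀2 : MemLp f₀ 2 volume := hf₀.mono_exponent le_top
  -- Both energies are compared with that of `f₀`: the case `p = 2` of the inequality for the
  -- viscous solution, exact conservation for `f`.
  have henergy : ∀ ν > 0, ∀ᵐ t ∂(timeMeasure T), ∫ x, (F ν t x) ^ 2 ≤ ∫ x, (f t x) ^ 2 :=
    fun ν hν => by
      obtain ⟨g, hg, hgw, hgL⟩ := hFcont ν hν
      filter_upwards [hg, ae_restrict_mem measurableSet_Icc, hren.ae_integral_sq hfC hf₀C]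
        with t ht htT hft
      rw [hft]
      have hg2 : MemLp (g t) 2 volume := (hgw.1 t htT).mono_exponent le_top
      refine integral_sq_le_of_eLpNorm_le (hg2.ae_eq ht.symm) hf₀2 ?_
      rw [eLpNorm_congr_ae ht]
      exact hgL 2 (by norm_num) t htT
  have hf2 := memLp_two_of_bound hfm hfC
  have hF2 := fun ν hν => memLp_two_of_bound (hFm ν hν) (hFC ν hν)
  have hL2 : Tendsto (fun ν => ∫ z, (F ν z.1 z.2 - f z.1 z.2) ^ 2 ∂(spaceTime d T))
      (𝓝[>] 0) (𝓝 0) :=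
    tendsto_integral_sub_sq (hpos.mono hF2) hf2
      (tendsto_weakStar_of_unique hu huniq hF hFC (hf2.integrable (by norm_num)))
      (hpos.mono fun ν hν => integral_sq_le_of_slices (hF2 ν hν) hf2 (henergy ν hν))
  refine ⟨⟨fun ν hν => memMixed_of_bound (hFm ν hν) (hFC ν hν) ∞ ∞, huniq.1, fun g hg =>
    tendsto_weakStar_of_unique hu huniq hF hFC (memMixed_one_iff.1 hg)⟩, fun p hp1 hp =>
    tendstoMixed_self hFm hFC hfm hfC hL2 hp1 hp, fun hc p hp1 hp =>
    tendstoMixed_top hu (hC₀.trans (le_max_left _ _)) huniq.2.1 hF hfC hFC henergy hL2 hc hp1 hp⟩
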